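/- Let $L,d\ge 1$ be integers, let $\mu_0,t_0,J>0$ be real, and let $\Omega=(\mathbb{Z}/L\mathbb{Z})^d$ be the periodic lattice with $L^d$ sites, with $e_1,\dots,e_d$ its coordinate unit vectors. Let $\Delta\in\mathbb{R}^{\Omega\times\Omega}$ be the periodic lattice Laplacian, $(\Delta f)(x)=\sum_{i=1}^d\big(f(x+e_i)+f(x-e_i)-2f(x)\big)$. For $u\in\mathbb{R}^{\Omega}\cong\mathbb{R}^{L^d}$ put $$a(u)=-t_0\Delta+\operatorname{diag}(u)+\mu_0\,\mathrm{Id}.$$ Then the following hold. 1. For every $u\in\mathbb{R}^{L^d}$ and every $z\in\mathbb{C}$ with $\operatorname{Im}z>0$ there is exactly one $m_\infty(u,z)\in\mathbb{C}^{\Omega}$ all of whose components have positive imaginary part and which satisfies $$m_\infty(u,z)_x=\Big[\big(a(u)-J^2\operatorname{diag}(m_\infty(u,z))-z\,\mathrm{Id}\big)^{-1}\Big]_{xx}\qquad\text{for all }x\in\Omega.$$ 2. For every $u$ there is exactly one probability measure $\mu_\infty(u,\cdot)$ on $\mathbb{R}$ with $$\int_{\mathbb{R}}\frac{\mu_\infty(u,\mathrm{d}s)}{s-z}=\frac1{L^d}\sum_{x\in\Omega}m_\infty(u,z)_x\qquad\text{for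 all }z\text{ with }\operatorname{Im}z>0;$$ it is absolutely continuous with respect to Lebesgue measure, and $\lambda\mapsto\log|\lambda|$ is integrable with respect to it. 3. The function $$\mathcal{S}[u]=\int_{\mathbb{R}}\log|\lambda|\,\mu_\infty(u,\mathrm{d}\lambda)-\frac{\|u\|^2}{2J^2L^d},$$ where $\|u\|$ is the Euclidean norm, is concave on $\mathbb{R}^{L^d}$. -/

import Mathlib

open MeasureTheory

noncomputable section

namespace ElasticManifold

/-- The periodic lattice with `L ^ d` sites. -/
abbrev Site (L d : ℕ) : Type := Fin d → ZMod L

/-- The periodic lattice Laplacian `(Δ f) x = ∑ i, (f (x + e i) + f (x - e i) - 2 f x)`, as a matrix.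
For `3 ≤ L` its entry at `(x, y)` is `1` if `x` and `y` are neighbours, `-2d` if `x = y`, and `0`
otherwise. -/
def laplacian (L d : ℕ) : Matrix (Site L d) (Site L d) ℝ :=
  Matrix.of fun x y =>
    (∑ i : Fin d, ((if y = x + Pi.single i 1 then (1 : ℝ) else 0) +
      (if y = x - Pi.single i 1 then (1 : ℝ) else 0))) -
    2 * (d : ℝ) * (if x = y then 1 else 0)

/-- The matrix `a(u) = -t₀ Δ + diag(u) + μ₀ Id`. -/
def aMatrix (L d : ℕ) (μ₀ t₀ : ℝ) (u : EuclideanSpace ℝ (Site L d)) :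
    Matrix (Site L d) (Site L d) ℝ :=
  -(t₀ • laplacian L d) + Matrix.diagonal (fun x => u x) + μ₀ • (1 : Matrix (Site L d) (Site L d) ℝ)

/-- `m` solves the diagonal matrix Dyson equation at `(u, z)`:
`m = diag ((a(u) - J² diag(m) - z Id)⁻¹)`, with all imaginary parts positive.
(The matrix is then invertible, since the inverse of a singular matrix is `0` by convention.) -/
def IsMDESolution (L d : ℕ) [NeZero L] (μ₀ t₀ J : ℝ) (u : EuclideanSpace ℝ (Site L d)) (z : ℂ)
    (m : Site L d → ℂ) : Prop :=
  (∀ x, m x = ((aMatrix L d μ₀ t₀ u).map (fun r : ℝ => (r : ℂ)) -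
      ((J : ℂ) ^ 2) • Matrix.diagonal m - z • (1 : Matrix (Site L d) (Site L d) ℂ))⁻¹ x x) ∧
  ∀ x, 0 < (m x).im

/-- The solution `m_∞(u, z)` of the diagonal matrix Dyson equation (for `z` in the upper
half-plane). -/
def mInfty (L d : ℕ) [NeZero L] (μ₀ t₀ J : ℝ) (u : EuclideanSpace ℝ (Site L d)) (z : ℂ) :
    Site L d → ℂ :=
  Classical.epsilon (IsMDESolution L d μ₀ t₀ J u z)

/-- `μ` is a probability measure on `ℝ` whose Stieltjes transform is
`z ↦ (1 / L ^ d) ∑ x, m_∞(u, z) x` on the upper half-plane. -/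
def IsMuInfty (L d : ℕ) [NeZero L] (μ₀ t₀ J : ℝ) (u : EuclideanSpace ℝ (Site L d))
    (μ : Measure ℝ) : Prop :=
  IsProbabilityMeasure μ ∧
  ∀ z : ℂ, 0 < z.im →
    ∫ s : ℝ, 1 / ((s : ℂ) - z) ∂μ = (1 / (L : ℂ) ^ d) * ∑ x, mInfty L d μ₀ t₀ J u z x

/-- The measure `μ_∞(u)`. -/
def muInfty (L d : ℕ) [NeZero L] (μ₀ t₀ J : ℝ) (u : EuclideanSpace ℝ (Site L d)) : Measure ℝ :=
  Classical.epsilon (IsMuInfty L d μ₀ t₀ J u)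

/-- `𝓢[u] = ∫ log |λ| μ_∞(u, dλ) - ‖u‖² / (2 J² L ^ d)`, with the Euclidean norm of `u`. -/
def functionalS (L d : ℕ) [NeZero L] (μ₀ t₀ J : ℝ) (u : EuclideanSpace ℝ (Site L d)) : ℝ :=
  (∫ x : ℝ, Real.log |x| ∂(muInfty L d μ₀ t₀ J u)) - ‖u‖ ^ 2 / (2 * J ^ 2 * (L : ℝ) ^ d)

end ElasticManifold

end

/-! Write G = (A - diag ω)⁻¹ with ω = p + J² m, so that the Dyson equation reads m_x = G_xx.
Allowing a site-dependent parameter p lets the potential enter as p = z - u.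

Everything rests on the Ward identity Im G_xx = ∑_y |G_xy|² Im ω_y. At a solution it gives |m| ≤ 1/J
and makes Im m a positive strict subsolution for the kernel J²|G_xy|². A Schur test with weight Im m
then bounds that kernel by J/(J+η) < 1 when Im p ≥ η. Inserted in the resolvent identity for two
solutions, this bounds the pairing of ω - ω' with J²(m - m') by J/(J+η) ‖ω - ω'‖²
(`norm_sum_conj_mul_le`). Since J²(m - m') = (ω - ω') - (p - p'), three facts follow: uniqueness,
Lipschitz dependence of ω on p, and monotonicity of Re ω under real shifts of p
(`sum_re_sub_mul_nonneg`).

Existence comes from iterating m ↦ diag G, a hyperbolic contraction. Its iterates are resolvent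
entries of finite symmetric matrices, hence Stieltjes transforms of probability measures with
uniformly bounded second moment; tightness passes this to the limit. Stieltjes inversion gives
uniqueness of the measure and, from |m| ≤ 1/J, a bounded density, so log|λ| is integrable at 0; the
second moment handles infinity.

For concavity, the free energy log|det(A - diag ω)| + (J²/2) Re ∑ m² is stationary in m at
solutions. Along p = iη its η-derivative is therefore that of the log potential, and agreement as η
→ ∞ identifies the two up to the number of sites. With p = iη - u, the u-gradient of the free energy
minus ‖u‖²/(2J²) is Re m - u/J² = J⁻² Re ω, which the monotonicity shows to be decreasing along
lines. Finally η → 0. -/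

open scoped Matrix

namespace ElasticManifold

/-! ### Generalized resolvents and the Ward identity. -/

section Dyson

variable {ι : Type*} [Fintype ι] [DecidableEq ι]

/-- The generalized resolvent `(A - diag ω)⁻¹` of a real matrix. -/
noncomputable def resolvent (A : Matrix ι ι ℝ) (ω : ι → ℂ) : Matrix ι ι ℂ :=
  (A.map (fun r : ℝ => (r : ℂ)) - Matrix.diagonal ω)⁻¹

omit [Fintype ι] [DecidableEq ι] in
theorem conjTranspose_map_ofReal {A : Matrix ι ι ℝ} (hA : A.IsSymm) :
    (A.map (fun r : ℝ => (r : ℂ))).conjTranspose = A.map (fun r : ℝ => (r : ℂ)) := by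
  ext x y
  simp [Matrix.conjTranspose_apply, hA.apply]

/-- A kernel vector v satisfies Av = ωv. Since v*Av is real, ∑ Im ω_x |v_x|² = 0, which forces v =
0. -/
theorem isUnit_det_sub_diagonal {A : Matrix ι ι ℝ} (hA : A.IsSymm) {ω : ι → ℂ}
    (hω : ∀ x, 0 < (ω x).im) :
    IsUnit (A.map (fun r : ℝ => (r : ℂ)) - Matrix.diagonal ω).det := by
  rw [isUnit_iff_ne_zero]
  intro h0
  obtain ⟨v, hv, hMv⟩ := Matrix.exists_mulVec_eq_zero_iff.mpr h0
  have hAv : A.map (fun r : ℝ => (r : ℂ)) *ᵥ v = fun x => ω x * v x := by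
    rw [Matrix.sub_mulVec, sub_eq_zero] at hMv
    rw [hMv]
    ext x
    simp [Matrix.mulVec_diagonal]
  have hherm : (A.map (fun r : ℝ => (r : ℂ))).IsHermitian := conjTranspose_map_ofReal hA
  have him := hherm.im_star_dotProduct_mulVec_self v
  rw [hAv] at him
  have hsum : ∑ x, (ω x).im * Complex.normSq (v x) = 0 := by
    rw [← him]
    simp only [dotProduct, Pi.star_apply]
    rw [RCLike.im_eq_complex_im, Complex.im_sum]
    refine Finset.sum_congr rfl fun x _ => ?_
    simp [Complex.normSq_apply]
    ring
  rw [Finset.sum_eq_zero_iff_of_nonneg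
    (fun x _ => mul_nonneg (hω x).le (Complex.normSq_nonneg _))] at hsum
  apply hv
  ext x
  have := hsum x (Finset.mem_univ x)
  simpa [(hω x).ne'] using this

theorem resolvent_transpose {A : Matrix ι ι ℝ} (hA : A.IsSymm) (ω : ι → ℂ) (x y : ι) :
    resolvent A ω x y = resolvent A ω y x := by
  have h : (resolvent A ω).transpose = resolvent A ω := by
    unfold resolvent
    rw [Matrix.transpose_nonsing_inv, Matrix.transpose_sub, Matrix.diagonal_transpose,
      ← Matrix.transpose_map, hA.eq]
  conv_lhs => rw [← h, Matrix.transpose_apply]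

theorem resolvent_sub_resolvent {A : Matrix ι ι ℝ} {ω ω' : ι → ℂ}
    (h : IsUnit (A.map (fun r : ℝ => (r : ℂ)) - Matrix.diagonal ω).det)
    (h' : IsUnit (A.map (fun r : ℝ => (r : ℂ)) - Matrix.diagonal ω').det) (x y : ι) :
    resolvent A ω x y - resolvent A ω' x y =
      ∑ k, resolvent A ω x k * (ω k - ω' k) * resolvent A ω' k y := by
  have key : resolvent A ω - resolvent A ω' =
      resolvent A ω * Matrix.diagonal (fun k => ω k - ω' k) * resolvent A ω' := by
    have e : Matrix.diagonal (fun k => ω k - ω' k) =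
        (A.map (fun r : ℝ => (r : ℂ)) - Matrix.diagonal ω') -
          (A.map (fun r : ℝ => (r : ℂ)) - Matrix.diagonal ω) := by
      rw [← Matrix.diagonal_sub]; abel
    unfold resolvent
    rw [e, mul_sub, sub_mul, mul_assoc, Matrix.mul_nonsing_inv _ h', mul_one,
      Matrix.nonsing_inv_mul _ h, one_mul]
  have := congrFun (congrFun key x) y
  rw [Matrix.sub_apply, Matrix.mul_apply] at this
  rw [this]
  simp [Matrix.mul_diagonal]

theorem resolvent_conj {A : Matrix ι ι ℝ} (hA : A.IsSymm) (ω : ι → ℂ) (x y : ι) :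
    resolvent A (fun k => (starRingEnd ℂ) (ω k)) x y = (starRingEnd ℂ) (resolvent A ω y x) := by
  have : resolvent A (fun k => (starRingEnd ℂ) (ω k)) = (resolvent A ω).conjTranspose := by
    unfold resolvent
    rw [Matrix.conjTranspose_nonsing_inv, Matrix.conjTranspose_sub, conjTranspose_map_ofReal hA,
      Matrix.diagonal_conjTranspose]
    rfl
  rw [this]
  rfl

/-- The Ward identity: apply the resolvent identity to ω and its conjugate, where the second
resolvent is the adjoint of the first. -/
theorem resolvent_apply_self_im {A : Matrix ι ι ℝ} (hA : A.IsSymm) {ω : ι → ℂ}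
    (hω : ∀ x, 0 < (ω x).im) (x : ι) :
    (resolvent A ω x x).im = ∑ y, ‖resolvent A ω x y‖ ^ 2 * (ω y).im := by
  have hu := isUnit_det_sub_diagonal hA hω
  have hu' : IsUnit (A.map (fun r : ℝ => (r : ℂ)) -
      Matrix.diagonal (fun k => (starRingEnd ℂ) (ω k))).det := by
    have : A.map (fun r : ℝ => (r : ℂ)) - Matrix.diagonal (fun k => (starRingEnd ℂ) (ω k)) =
        (A.map (fun r : ℝ => (r : ℂ)) - Matrix.diagonal ω).conjTranspose := by
      rw [Matrix.conjTranspose_sub, conjTranspose_map_ofReal hA, Matrix.diagonal_conjTranspose]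
      rfl
    rw [this, Matrix.det_conjTranspose]
    exact hu.star
  have h := congrArg Complex.im (resolvent_sub_resolvent hu hu' x x)
  simp only [resolvent_conj hA, Complex.im_sum, Complex.sub_im, Complex.conj_im] at h
  have h2 : 2 * (resolvent A ω x x).im =
      2 * ∑ y, ‖resolvent A ω x y‖ ^ 2 * (ω y).im := by
    rw [Finset.mul_sum]
    calc _ = _ := by ring
      _ = _ := h
      _ = _ := by
        refine Finset.sum_congr rfl fun y _ => ?_
        rw [Complex.sub_conj, ← Complex.normSq_eq_norm_sq, Complex.normSq_apply]
        simp
        ring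
  linarith

theorem resolvent_apply_self_im_pos {A : Matrix ι ι ℝ} (hA : A.IsSymm) {ω : ι → ℂ}
    (hω : ∀ x, 0 < (ω x).im) (x : ι) : 0 < (resolvent A ω x x).im := by
  have hnn : ∀ y ∈ Finset.univ, 0 ≤ ‖resolvent A ω x y‖ ^ 2 * (ω y).im :=
    fun y _ => mul_nonneg (by positivity) (hω y).le
  rw [resolvent_apply_self_im hA hω]
  refine lt_of_le_of_ne (Finset.sum_nonneg hnn) fun h0 => ?_
  have hz := (Finset.sum_eq_zero_iff_of_nonneg hnn).mp h0.symm
  have hrow : ∀ y, resolvent A ω x y = 0 := fun y => by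
    have := hz y (Finset.mem_univ y)
    simpa [(hω y).ne'] using this
  have hu := isUnit_det_sub_diagonal hA hω
  have h1 := congrFun (congrFun (Matrix.nonsing_inv_mul _ hu) x) x
  rw [Matrix.mul_apply] at h1
  change ∑ j, resolvent A ω x j * _ = _ at h1
  simp [hrow] at h1

/-- `m` solves the diagonal matrix Dyson equation with site-dependent spectral parameter `p`. -/
def IsDysonSolution (A : Matrix ι ι ℝ) (J : ℝ) (p m : ι → ℂ) : Prop :=
  (∀ x, m x = resolvent A (fun y => p y + (J : ℂ) ^ 2 * m y) x x) ∧ ∀ x, 0 < (m x).im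

omit [Fintype ι] [DecidableEq ι] in
theorem im_add_sq_mul (J : ℝ) (p m : ι → ℂ) (x : ι) :
    (p x + (J : ℂ) ^ 2 * m x).im = (p x).im + J ^ 2 * (m x).im := by
  rw [← Complex.ofReal_pow]
  simp only [Complex.add_im, Complex.im_ofReal_mul]

/-! ### A priori bounds, stability and monotonicity of solutions. -/

namespace IsDysonSolution

variable {A : Matrix ι ι ℝ} {J η : ℝ} {p p' m m' : ι → ℂ}

omit [Fintype ι] [DecidableEq ι] in
theorem im_pos (hp : ∀ x, 0 < (p x).im) (hm : ∀ x, 0 ≤ (m x).im) (x : ι) :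
    0 < (p x + (J : ℂ) ^ 2 * m x).im := by
  rw [im_add_sq_mul]
  have := hp x
  have := mul_nonneg (sq_nonneg J) (hm x)
  linarith

theorem im_eq (hA : A.IsSymm) (hp : ∀ x, 0 < (p x).im) (h : IsDysonSolution A J p m) (x : ι) :
    (m x).im = ∑ y, ‖resolvent A (fun y => p y + (J : ℂ) ^ 2 * m y) x y‖ ^ 2 *
      ((p y).im + J ^ 2 * (m y).im) := by
  have h1 := resolvent_apply_self_im hA (ω := fun y => p y + (J : ℂ) ^ 2 * m y)
    (im_pos hp fun x => (h.2 x).le) x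
  rw [← h.1 x] at h1
  rw [h1]
  simp only [im_add_sq_mul]

/-- Only the term y = x of the Ward sum is kept; there the resolvent entry is m_x itself. -/
theorem norm_sq_mul_le (hA : A.IsSymm) (hp : ∀ x, 0 < (p x).im) (h : IsDysonSolution A J p m)
    (x : ι) : ‖m x‖ ^ 2 * ((p x).im + J ^ 2 * (m x).im) ≤ (m x).im := by
  conv_rhs => rw [im_eq hA hp h x]
  conv_lhs => enter [1]; rw [h.1 x]
  exact Finset.single_le_sum (f := fun y => ‖resolvent A (fun y => p y + (J : ℂ) ^ 2 * m y) x y‖ ^ 2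
    * ((p y).im + J ^ 2 * (m y).im))
    (fun y _ => mul_nonneg (by positivity)
      (add_nonneg (hp y).le (mul_nonneg (sq_nonneg J) (h.2 y).le))) (Finset.mem_univ x)

theorem norm_le (hJ : 0 < J) (hA : A.IsSymm) (hp : ∀ x, 0 < (p x).im)
    (h : IsDysonSolution A J p m) (x : ι) : ‖m x‖ ≤ 1 / J := by
  have h1 := norm_sq_mul_le hA hp h x
  have hv := h.2 x
  have h2 : (‖m x‖ * J) ^ 2 * (m x).im ≤ 1 * (m x).im := by
    nlinarith [mul_nonneg (sq_nonneg ‖m x‖) (hp x).le]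
  have h3 := le_of_mul_le_mul_right h2 hv
  rw [le_div_iff₀ hJ]
  exact (sq_le_one_iff₀ (by positivity)).mp h3

theorem norm_le_inv (hη : 0 < η) (hA : A.IsSymm) (hp : ∀ x, η ≤ (p x).im)
    (h : IsDysonSolution A J p m) (x : ι) : ‖m x‖ ≤ 1 / η := by
  have h1 := norm_sq_mul_le hA (fun x => hη.trans_le (hp x)) h x
  have hv := h.2 x
  have hpos : 0 < ‖m x‖ := norm_pos_iff.mpr fun h0 => by simp [h0] at hv
  have h2 : (m x).im ≤ ‖m x‖ := (le_abs_self _).trans (Complex.abs_im_le_norm _)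
  have h3 : ‖m x‖ ^ 2 * η ≤ ‖m x‖ := by
    refine le_trans ?_ (h1.trans h2)
    refine mul_le_mul_of_nonneg_left ?_ (by positivity)
    have := mul_nonneg (sq_nonneg J) hv.le
    linarith [hp x]
  rw [le_div_iff₀ hη]
  nlinarith

/-- Makes Im m an admissible Schur weight with a constant below 1. The gain comes from |m| ≤ 1/J:
then Jη Im m ≤ η ≤ Im p, so J(J+η) Im m is at most Im ω. -/
theorem row_sum_le (hJ : 0 < J) (hη : 0 < η) (hA : A.IsSymm) (hp : ∀ x, η ≤ (p x).im)
    (h : IsDysonSolution A J p m) (x : ι) :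
    J ^ 2 * ∑ y, ‖resolvent A (fun y => p y + (J : ℂ) ^ 2 * m y) x y‖ ^ 2 * (m y).im ≤
      J / (J + η) * (m x).im := by
  have hp' : ∀ x, 0 < (p x).im := fun x => hη.trans_le (hp x)
  rw [div_mul_eq_mul_div, le_div_iff₀ (by positivity)]
  have h1 : (J + η) * J * ∑ y, ‖resolvent A (fun y => p y + (J : ℂ) ^ 2 * m y) x y‖ ^ 2 *
      (m y).im ≤ (m x).im := by
    conv_rhs => rw [im_eq hA hp' h x]
    rw [Finset.mul_sum]
    refine Finset.sum_le_sum fun y _ => ?_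
    have hv : (m y).im * J ≤ 1 := by
      have := (le_abs_self _).trans ((Complex.abs_im_le_norm _).trans (norm_le hJ hA hp' h y))
      rwa [le_div_iff₀ hJ] at this
    have h3 : (J + η) * J * (m y).im ≤ (p y).im + J ^ 2 * (m y).im := by
      nlinarith [hp y]
    calc _ = ‖resolvent A (fun y => p y + (J : ℂ) ^ 2 * m y) x y‖ ^ 2 *
          ((J + η) * J * (m y).im) := by ring
      _ ≤ _ := mul_le_mul_of_nonneg_left h3 (by positivity)
  calc _ = J * ((J + η) * J * ∑ y, ‖resolvent A (fun y => p y + (J : ℂ) ^ 2 * m y) x y‖ ^ 2 *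
      (m y).im) := by ring
    _ ≤ _ := mul_le_mul_of_nonneg_left h1 hJ.le

/-- A weighted Schur test for the squared absolute values of the resolvent. -/
theorem sum_norm_sq_le (hJ : 0 < J) (hη : 0 < η) (hA : A.IsSymm) (hp : ∀ x, η ≤ (p x).im)
    (h : IsDysonSolution A J p m) (e : ι → ℂ) :
    J ^ 2 * ∑ x, ∑ y, ‖e x‖ * ‖resolvent A (fun y => p y + (J : ℂ) ^ 2 * m y) x y‖ ^ 2 * ‖e y‖ ≤
      J / (J + η) * ∑ x, ‖e x‖ ^ 2 := by
  set G := resolvent A (fun y => p y + (J : ℂ) ^ 2 * m y) with hG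
  have hsymm : ∀ x y, G x y = G y x := resolvent_transpose hA _
  have b1 : J ^ 2 * ∑ x, ∑ y, ‖G x y‖ ^ 2 * (m y).im * (‖e x‖ ^ 2 / (m x).im) ≤
      J / (J + η) * ∑ x, ‖e x‖ ^ 2 := by
    rw [Finset.mul_sum, Finset.mul_sum]
    refine Finset.sum_le_sum fun x _ => ?_
    rw [← Finset.sum_mul, ← mul_assoc]
    have := mul_le_mul_of_nonneg_right (row_sum_le hJ hη hA hp h x)
      (div_nonneg (sq_nonneg ‖e x‖) (h.2 x).le)
    refine this.trans (le_of_eq ?_)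
    have := (h.2 x).ne'
    field_simp
  have b2 : ∑ x, ∑ y, ‖G x y‖ ^ 2 * (m x).im * (‖e y‖ ^ 2 / (m y).im) =
      ∑ x, ∑ y, ‖G x y‖ ^ 2 * (m y).im * (‖e x‖ ^ 2 / (m x).im) := by
    rw [Finset.sum_comm]
    exact Finset.sum_congr rfl fun x _ => Finset.sum_congr rfl fun y _ => by rw [hsymm y x]
  have b3 : ∑ x, ∑ y, ‖e x‖ * ‖G x y‖ ^ 2 * ‖e y‖ ≤
      (∑ x, ∑ y, ‖G x y‖ ^ 2 * (m y).im * (‖e x‖ ^ 2 / (m x).im) +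
        ∑ x, ∑ y, ‖G x y‖ ^ 2 * (m x).im * (‖e y‖ ^ 2 / (m y).im)) / 2 := by
    rw [← Finset.sum_add_distrib, Finset.sum_div]
    refine Finset.sum_le_sum fun x _ => ?_
    rw [← Finset.sum_add_distrib, Finset.sum_div]
    refine Finset.sum_le_sum fun y _ => ?_
    have hx := h.2 x
    have hy := h.2 y
    -- AM-GM with weight Im m_y / Im m_x, chosen so that each half becomes a row sum controlled by
    -- `row_sum_le`.
    have key : ‖e x‖ * ‖e y‖ ≤
        ((m y).im * (‖e x‖ ^ 2 / (m x).im) + (m x).im * (‖e y‖ ^ 2 / (m y).im)) / 2 := by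
      rw [← sub_nonneg]
      have : ((m y).im * (‖e x‖ ^ 2 / (m x).im) + (m x).im * (‖e y‖ ^ 2 / (m y).im)) / 2 -
          ‖e x‖ * ‖e y‖ =
          (‖e x‖ * (m y).im - ‖e y‖ * (m x).im) ^ 2 / (2 * (m x).im * (m y).im) := by
        field_simp
        ring
      rw [this]
      positivity
    calc _ = ‖G x y‖ ^ 2 * (‖e x‖ * ‖e y‖) := by ring
      _ ≤ _ := mul_le_mul_of_nonneg_left key (by positivity)
      _ = _ := by ring
  rw [b2] at b3
  refine le_trans (mul_le_mul_of_nonneg_left b3 (sq_nonneg J)) ?_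
  linarith

/-- A weighted Schur test for the entrywise product of two resolvents. -/
theorem sum_norm_mul_norm_le (hJ : 0 < J) (hη : 0 < η) (hA : A.IsSymm) (hp : ∀ x, η ≤ (p x).im)
    (hp' : ∀ x, η ≤ (p' x).im) (h : IsDysonSolution A J p m) (h' : IsDysonSolution A J p' m')
    (e : ι → ℂ) :
    J ^ 2 * ∑ x, ∑ y, ‖e x‖ * (‖resolvent A (fun y => p y + (J : ℂ) ^ 2 * m y) x y‖ *
      ‖resolvent A (fun y => p' y + (J : ℂ) ^ 2 * m' y) x y‖) * ‖e y‖ ≤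
      J / (J + η) * ∑ x, ‖e x‖ ^ 2 := by
  have b := sum_norm_sq_le hJ hη hA hp h e
  have b' := sum_norm_sq_le hJ hη hA hp' h' e
  set G := resolvent A (fun y => p y + (J : ℂ) ^ 2 * m y)
  set G' := resolvent A (fun y => p' y + (J : ℂ) ^ 2 * m' y)
  have b3 : ∑ x, ∑ y, ‖e x‖ * (‖G x y‖ * ‖G' x y‖) * ‖e y‖ ≤
      (∑ x, ∑ y, ‖e x‖ * ‖G x y‖ ^ 2 * ‖e y‖ + ∑ x, ∑ y, ‖e x‖ * ‖G' x y‖ ^ 2 * ‖e y‖) / 2 := by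
    rw [← Finset.sum_add_distrib, Finset.sum_div]
    refine Finset.sum_le_sum fun x _ => ?_
    rw [← Finset.sum_add_distrib, Finset.sum_div]
    refine Finset.sum_le_sum fun y _ => ?_
    have key : ‖G x y‖ * ‖G' x y‖ ≤ (‖G x y‖ ^ 2 + ‖G' x y‖ ^ 2) / 2 := by
      nlinarith [sq_nonneg (‖G x y‖ - ‖G' x y‖)]
    calc _ = (‖e x‖ * ‖e y‖) * (‖G x y‖ * ‖G' x y‖) := by ring
      _ ≤ _ := mul_le_mul_of_nonneg_left key (by positivity)
      _ = _ := by ring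
  refine le_trans (mul_le_mul_of_nonneg_left b3 (sq_nonneg J)) ?_
  linarith

/-- The resolvent identity and symmetry of G' express m - m' as the kernel G_xy G'_xy applied to ω -
ω'; the Schur test for that product does the rest. -/
theorem norm_sum_conj_mul_le (hJ : 0 < J) (hη : 0 < η) (hA : A.IsSymm) (hp : ∀ x, η ≤ (p x).im)
    (hp' : ∀ x, η ≤ (p' x).im) (h : IsDysonSolution A J p m) (h' : IsDysonSolution A J p' m') :
    ‖∑ x, (starRingEnd ℂ) ((p x + (J : ℂ) ^ 2 * m x) - (p' x + (J : ℂ) ^ 2 * m' x)) *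
      ((J : ℂ) ^ 2 * (m x - m' x))‖ ≤
      J / (J + η) * ∑ x, ‖(p x + (J : ℂ) ^ 2 * m x) - (p' x + (J : ℂ) ^ 2 * m' x)‖ ^ 2 := by
  refine le_trans ?_ (sum_norm_mul_norm_le hJ hη hA hp hp' h h' _)
  have hd : ∀ x, m x - m' x = ∑ y, resolvent A (fun y => p y + (J : ℂ) ^ 2 * m y) x y *
      ((p y + (J : ℂ) ^ 2 * m y) - (p' y + (J : ℂ) ^ 2 * m' y)) *
      resolvent A (fun y => p' y + (J : ℂ) ^ 2 * m' y) y x := fun x => by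
    conv_lhs => rw [h.1 x, h'.1 x]
    exact resolvent_sub_resolvent
      (isUnit_det_sub_diagonal hA (im_pos (fun x => hη.trans_le (hp x)) fun x => (h.2 x).le))
      (isUnit_det_sub_diagonal hA (im_pos (fun x => hη.trans_le (hp' x)) fun x => (h'.2 x).le)) x x
  rw [Finset.mul_sum]
  refine (norm_sum_le _ _).trans (Finset.sum_le_sum fun x _ => ?_)
  rw [hd x, norm_mul, norm_mul, RCLike.norm_conj, norm_pow, Complex.norm_real, Real.norm_eq_abs,
    sq_abs, mul_left_comm]
  refine mul_le_mul_of_nonneg_left ?_ (sq_nonneg J)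
  refine (mul_le_mul_of_nonneg_left (norm_sum_le _ _) (norm_nonneg _)).trans (le_of_eq ?_)
  rw [Finset.mul_sum]
  refine Finset.sum_congr rfl fun y _ => ?_
  rw [norm_mul, norm_mul, resolvent_transpose hA _ y x]
  ring

omit [DecidableEq ι] in
theorem sum_conj_mul_eq (p p' m m' : ι → ℂ) (J : ℝ) :
    ∑ x, (starRingEnd ℂ) ((p x + (J : ℂ) ^ 2 * m x) - (p' x + (J : ℂ) ^ 2 * m' x)) *
      ((J : ℂ) ^ 2 * (m x - m' x)) =
    ((∑ x, ‖(p x + (J : ℂ) ^ 2 * m x) - (p' x + (J : ℂ) ^ 2 * m' x)‖ ^ 2 : ℝ) : ℂ) -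
    ∑ x, (starRingEnd ℂ) ((p x + (J : ℂ) ^ 2 * m x) - (p' x + (J : ℂ) ^ 2 * m' x)) *
      (p x - p' x) := by
  rw [Complex.ofReal_sum, ← Finset.sum_sub_distrib]
  refine Finset.sum_congr rfl fun x _ => ?_
  rw [Complex.ofReal_pow, ← Complex.conj_mul']
  ring

/-- Lipschitz stability of ω in p. The gap r = 1 - J/(J+η) = η/(J+η) leaves r‖ω - ω'‖² bounded by
the pairing with p - p', and Young's inequality with weight r absorbs half of it. -/
theorem sum_norm_sq_sub_le (hJ : 0 < J) (hη : 0 < η) (hA : A.IsSymm) (hp : ∀ x, η ≤ (p x).im)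
    (hp' : ∀ x, η ≤ (p' x).im) (h : IsDysonSolution A J p m) (h' : IsDysonSolution A J p' m') :
    (η / (J + η)) ^ 2 * ∑ x, ‖(p x + (J : ℂ) ^ 2 * m x) - (p' x + (J : ℂ) ^ 2 * m' x)‖ ^ 2 ≤
      ∑ x, ‖p x - p' x‖ ^ 2 := by
  have h1 := norm_sum_conj_mul_le hJ hη hA hp hp' h h'
  rw [sum_conj_mul_eq] at h1
  have h2 := (norm_sub_norm_le _ _).trans h1
  set E := ∑ x, ‖(p x + (J : ℂ) ^ 2 * m x) - (p' x + (J : ℂ) ^ 2 * m' x)‖ ^ 2 with hE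
  have hE0 : 0 ≤ E := Finset.sum_nonneg fun x _ => by positivity
  rw [Complex.norm_real, Real.norm_eq_abs, abs_of_nonneg hE0] at h2
  have hr : J / (J + η) = 1 - η / (J + η) := by field_simp; ring
  set r := η / (J + η) with hr'
  have hr0 : 0 < r := by positivity
  rw [hr] at h2
  have h3 : ‖∑ x, (starRingEnd ℂ) ((p x + (J : ℂ) ^ 2 * m x) - (p' x + (J : ℂ) ^ 2 * m' x)) *
      (p x - p' x)‖ ≤ (r * E + r⁻¹ * ∑ x, ‖p x - p' x‖ ^ 2) / 2 := by
    refine (norm_sum_le _ _).trans ?_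
    rw [hE, Finset.mul_sum, Finset.mul_sum, ← Finset.sum_add_distrib, Finset.sum_div]
    refine Finset.sum_le_sum fun x _ => ?_
    rw [norm_mul, RCLike.norm_conj]
    set a := ‖(p x + (J : ℂ) ^ 2 * m x) - (p' x + (J : ℂ) ^ 2 * m' x)‖
    set b := ‖p x - p' x‖
    rw [← sub_nonneg]
    have : (r * a ^ 2 + r⁻¹ * b ^ 2) / 2 - a * b = (r * a - b) ^ 2 / (2 * r) := by
      field_simp
      ring
    rw [this]
    positivity
  have h4 : r * E ≤ r⁻¹ * ∑ x, ‖p x - p' x‖ ^ 2 := by linarith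
  have h5 := mul_le_mul_of_nonneg_left h4 hr0.le
  rw [mul_inv_cancel_left₀ hr0.ne'] at h5
  linarith

theorem unique (hJ : 0 < J) (hη : 0 < η) (hA : A.IsSymm) (hp : ∀ x, η ≤ (p x).im)
    (h : IsDysonSolution A J p m) (h' : IsDysonSolution A J p m') : m = m' := by
  have h1 := sum_norm_sq_sub_le hJ hη hA hp hp h h'
  simp only [sub_self, norm_zero] at h1
  have hr0 : 0 < (η / (J + η)) ^ 2 := by positivity
  have hE0 : 0 ≤ ∑ x, ‖(p x + (J : ℂ) ^ 2 * m x) - (p x + (J : ℂ) ^ 2 * m' x)‖ ^ 2 :=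
    Finset.sum_nonneg fun x _ => by positivity
  have h2 : ∑ x, ‖(p x + (J : ℂ) ^ 2 * m x) - (p x + (J : ℂ) ^ 2 * m' x)‖ ^ 2 = 0 := by
    refine le_antisymm ?_ hE0
    refine le_of_mul_le_mul_left (h1.trans ?_) hr0
    simp
  rw [Finset.sum_eq_zero_iff_of_nonneg (fun x _ => by positivity)] at h2
  ext x
  have := h2 x (Finset.mem_univ x)
  rw [add_sub_add_left_eq_sub, ← mul_sub] at this
  simpa [hJ.ne', sub_eq_zero] using this

/-- The solution is monotone, up to the linear term, under real shifts of the spectral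
parameter. -/
theorem sum_re_sub_mul_nonneg (hJ : 0 < J) (hη : 0 < η) (hA : A.IsSymm)
    (hp : ∀ x, η ≤ (p x).im) (hp' : ∀ x, η ≤ (p' x).im) (h : IsDysonSolution A J p m)
    (h' : IsDysonSolution A J p' m') (hpp : ∀ x, (p x - p' x).im = 0) :
    0 ≤ ∑ x, (p x - p' x).re *
      ((p x + (J : ℂ) ^ 2 * m x) - (p' x + (J : ℂ) ^ 2 * m' x)).re := by
  have h1 := norm_sum_conj_mul_le hJ hη hA hp hp' h h'
  rw [sum_conj_mul_eq] at h1
  have h2 := (Complex.re_le_norm _).trans h1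
  rw [Complex.sub_re, Complex.ofReal_re, Complex.re_sum] at h2
  have hE0 : 0 ≤ ∑ x, ‖(p x + (J : ℂ) ^ 2 * m x) - (p' x + (J : ℂ) ^ 2 * m' x)‖ ^ 2 :=
    Finset.sum_nonneg fun x _ => by positivity
  have h3 := mul_le_mul_of_nonneg_right
    ((div_le_one (by positivity)).mpr (by linarith : J ≤ J + η)) hE0
  have h4 : ∀ x, ((starRingEnd ℂ) ((p x + (J : ℂ) ^ 2 * m x) - (p' x + (J : ℂ) ^ 2 * m' x)) *
      (p x - p' x)).re = (p x - p' x).re *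
      ((p x + (J : ℂ) ^ 2 * m x) - (p' x + (J : ℂ) ^ 2 * m' x)).re := fun x => by
    rw [Complex.mul_re, hpp x, Complex.conj_re]
    ring
  simp only [h4] at h2
  linarith

end IsDysonSolution

/-! ### Existence by a hyperbolic contraction. -/

section Existence

variable {A : Matrix ι ι ℝ} {J η : ℝ} {p : ι → ℂ}

/-- The fixed-point map of the diagonal matrix Dyson equation. -/
noncomputable def dysonMap (A : Matrix ι ι ℝ) (J : ℝ) (p m : ι → ℂ) : ι → ℂ :=
  fun x => resolvent A (fun y => p y + (J : ℂ) ^ 2 * m y) x x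

theorem dysonMap_im_pos (hA : A.IsSymm) (hp : ∀ x, 0 < (p x).im) {m : ι → ℂ}
    (hm : ∀ x, 0 ≤ (m x).im) (x : ι) : 0 < (dysonMap A J p m x).im :=
  resolvent_apply_self_im_pos hA (IsDysonSolution.im_pos hp hm) x

theorem dysonMap_im_eq (hA : A.IsSymm) (hp : ∀ x, 0 < (p x).im) {m : ι → ℂ}
    (hm : ∀ x, 0 ≤ (m x).im) (x : ι) : (dysonMap A J p m x).im =
      ∑ y, ‖resolvent A (fun y => p y + (J : ℂ) ^ 2 * m y) x y‖ ^ 2 *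
        ((p y).im + J ^ 2 * (m y).im) := by
  rw [dysonMap, resolvent_apply_self_im hA (IsDysonSolution.im_pos hp hm)]
  simp only [im_add_sq_mul]

theorem dysonMap_im_le (hη : 0 < η) (hA : A.IsSymm) (hp : ∀ x, η ≤ (p x).im) {m : ι → ℂ}
    (hm : ∀ x, 0 ≤ (m x).im) (x : ι) : (dysonMap A J p m x).im ≤ 1 / η := by
  have hp' : ∀ x, 0 < (p x).im := fun x => hη.trans_le (hp x)
  have h1 := dysonMap_im_eq (J := J) hA hp' hm x
  have hpos := dysonMap_im_pos (J := J) hA hp' hm x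
  have h2 : ‖dysonMap A J p m x‖ ^ 2 * ((p x).im + J ^ 2 * (m x).im) ≤
      (dysonMap A J p m x).im := by
    conv_rhs => rw [h1]
    exact Finset.single_le_sum (f := fun y => ‖resolvent A (fun y => p y + (J : ℂ) ^ 2 * m y) x y‖
      ^ 2 * ((p y).im + J ^ 2 * (m y).im))
      (fun y _ => mul_nonneg (by positivity)
        (add_nonneg (hp' y).le (mul_nonneg (sq_nonneg J) (hm y)))) (Finset.mem_univ x)
  have h3 : (dysonMap A J p m x).im ^ 2 ≤ ‖dysonMap A J p m x‖ ^ 2 := by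
    rw [← sq_abs]
    exact pow_le_pow_left₀ (abs_nonneg _) (Complex.abs_im_le_norm _) 2
  have h4 : η ≤ (p x).im + J ^ 2 * (m x).im := by
    have := mul_nonneg (sq_nonneg J) (hm x)
    linarith [hp x]
  rw [le_div_iff₀ hη]
  have h5 : (dysonMap A J p m x).im ^ 2 * η ≤ (dysonMap A J p m x).im :=
    (mul_le_mul h3 h4 hη.le (by positivity)).trans h2
  nlinarith

/-- The fixed-point map contracts the hyperbolic distance. -/
theorem norm_dysonMap_sub_sq_le (hJ : 0 < J) (hη : 0 < η) (hA : A.IsSymm)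
    (hp : ∀ x, η ≤ (p x).im) {a b : ι → ℂ} (ha : ∀ x, 0 < (a x).im) (hb : ∀ x, 0 < (b x).im)
    (ha' : ∀ x, (a x).im ≤ 1 / η) (hb' : ∀ x, (b x).im ≤ 1 / η) {C : ℝ} (hC : 0 ≤ C)
    (h : ∀ x, ‖a x - b x‖ ^ 2 ≤ C ^ 2 * ((a x).im * (b x).im)) (x : ι) :
    ‖dysonMap A J p a x - dysonMap A J p b x‖ ^ 2 ≤
      (J ^ 2 / (J ^ 2 + η ^ 2) * C) ^ 2 *
        ((dysonMap A J p a x).im * (dysonMap A J p b x).im) := by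
  have hp' : ∀ x, 0 < (p x).im := fun x => hη.trans_le (hp x)
  set q := J ^ 2 / (J ^ 2 + η ^ 2) with hq
  have row : ∀ c : ι → ℂ, (∀ x, 0 < (c x).im) → (∀ x, (c x).im ≤ 1 / η) →
      J ^ 2 * ∑ y, ‖resolvent A (fun y => p y + (J : ℂ) ^ 2 * c y) x y‖ ^ 2 * (c y).im ≤
        q * (dysonMap A J p c x).im := fun c hc hc' => by
    rw [dysonMap_im_eq hA hp' (fun x => (hc x).le), Finset.mul_sum, Finset.mul_sum]
    refine Finset.sum_le_sum fun y _ => ?_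
    -- From Im c ≤ 1/η one gets η² Im c ≤ η ≤ Im p, which explains the factor q = J²/(J²+η²).
    have h1 : J ^ 2 * (c y).im ≤ q * ((p y).im + J ^ 2 * (c y).im) := by
      rw [hq, div_mul_eq_mul_div, le_div_iff₀ (by positivity)]
      have h2 : (c y).im * η ≤ 1 := by
        have := hc' y
        rwa [le_div_iff₀ hη] at this
      have h3 : (c y).im * η ^ 2 ≤ (p y).im := by nlinarith [hp y]
      nlinarith [mul_le_mul_of_nonneg_left h3 (sq_nonneg J)]
    calc _ = ‖resolvent A (fun y => p y + (J : ℂ) ^ 2 * c y) x y‖ ^ 2 * (J ^ 2 * (c y).im) := by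
          ring
      _ ≤ _ := mul_le_mul_of_nonneg_left h1 (by positivity)
      _ = _ := by ring
  have hd : dysonMap A J p a x - dysonMap A J p b x = _ :=
    resolvent_sub_resolvent
      (isUnit_det_sub_diagonal hA (IsDysonSolution.im_pos hp' fun x => (ha x).le))
      (isUnit_det_sub_diagonal hA (IsDysonSolution.im_pos hp' fun x => (hb x).le)) x x
  have ra := row a ha ha'
  have rb := row b hb hb'
  set G := resolvent A (fun y => p y + (J : ℂ) ^ 2 * a y) with hG
  set G' := resolvent A (fun y => p y + (J : ℂ) ^ 2 * b y) with hG'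
  have hsymm : ∀ y, G' y x = G' x y := fun y => resolvent_transpose hA _ y x
  have h1 : ‖dysonMap A J p a x - dysonMap A J p b x‖ ≤
      J ^ 2 * C * ∑ y, (‖G x y‖ * √(a y).im) * (‖G' x y‖ * √(b y).im) := by
    rw [hd, Finset.mul_sum]
    refine (norm_sum_le _ _).trans (Finset.sum_le_sum fun y _ => ?_)
    rw [add_sub_add_left_eq_sub, ← mul_sub, norm_mul, norm_mul, norm_mul, norm_pow,
      Complex.norm_real, Real.norm_eq_abs, sq_abs, hsymm y]
    have h2 : ‖a y - b y‖ ≤ C * (√(a y).im * √(b y).im) := by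
      refine (sq_le_sq₀ (by positivity) (by positivity)).mp ?_
      rw [mul_pow, mul_pow, Real.sq_sqrt (ha y).le, Real.sq_sqrt (hb y).le]
      exact h y
    calc _ = (J ^ 2 * ‖G x y‖ * ‖G' x y‖) * ‖a y - b y‖ := by ring
      _ ≤ _ := mul_le_mul_of_nonneg_left h2 (by positivity)
      _ = _ := by ring
  have h2 := Finset.sum_mul_sq_le_sq_mul_sq Finset.univ (fun y => ‖G x y‖ * √(a y).im)
    (fun y => ‖G' x y‖ * √(b y).im)
  have e1 : ∑ y, (‖G x y‖ * √(a y).im) ^ 2 = ∑ y, ‖G x y‖ ^ 2 * (a y).im :=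
    Finset.sum_congr rfl fun y _ => by rw [mul_pow, Real.sq_sqrt (ha y).le]
  have e2 : ∑ y, (‖G' x y‖ * √(b y).im) ^ 2 = ∑ y, ‖G' x y‖ ^ 2 * (b y).im :=
    Finset.sum_congr rfl fun y _ => by rw [mul_pow, Real.sq_sqrt (hb y).le]
  simp only [e1, e2] at h2
  have h3 : ‖dysonMap A J p a x - dysonMap A J p b x‖ ^ 2 ≤ _ :=
    pow_le_pow_left₀ (norm_nonneg _) h1 2
  have hsb : 0 ≤ ∑ y, ‖G' x y‖ ^ 2 * (b y).im :=
    Finset.sum_nonneg fun y _ => mul_nonneg (by positivity) (hb y).le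
  have hqa : 0 ≤ q * (dysonMap A J p a x).im :=
    mul_nonneg (by positivity) (dysonMap_im_pos hA hp' (fun x => (ha x).le) x).le
  calc _ ≤ _ := h3
    _ = C ^ 2 * (J ^ 2) ^ 2 * (∑ y, (‖G x y‖ * √(a y).im) * (‖G' x y‖ * √(b y).im)) ^ 2 := by ring
    _ ≤ C ^ 2 * (J ^ 2) ^ 2 * ((∑ y, ‖G x y‖ ^ 2 * (a y).im) * ∑ y, ‖G' x y‖ ^ 2 * (b y).im) :=
        mul_le_mul_of_nonneg_left h2 (by positivity)
    _ = C ^ 2 * ((J ^ 2 * ∑ y, ‖G x y‖ ^ 2 * (a y).im) *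
          (J ^ 2 * ∑ y, ‖G' x y‖ ^ 2 * (b y).im)) := by ring
    _ ≤ C ^ 2 * ((q * (dysonMap A J p a x).im) * (q * (dysonMap A J p b x).im)) := by
        refine mul_le_mul_of_nonneg_left ?_ (sq_nonneg C)
        exact mul_le_mul ra rb (by positivity) hqa
    _ = _ := by ring

theorem continuousAt_resolvent (A : Matrix ι ι ℝ) {ω : ι → ℂ}
    (h : IsUnit (A.map (fun r : ℝ => (r : ℂ)) - Matrix.diagonal ω).det) :
    ContinuousAt (resolvent A) ω := by
  have hc : Continuous fun ω : ι → ℂ => A.map (fun r : ℝ => (r : ℂ)) - Matrix.diagonal ω :=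
    continuous_const.sub (Continuous.matrix_diagonal continuous_id)
  have he : resolvent A = fun ω : ι → ℂ =>
      (A.map (fun r : ℝ => (r : ℂ)) - Matrix.diagonal ω).det⁻¹ •
        (A.map (fun r : ℝ => (r : ℂ)) - Matrix.diagonal ω).adjugate := by
    ext1 ω
    rw [resolvent, Matrix.inv_def, Ring.inverse_eq_inv']
  rw [he]
  exact (hc.matrix_det.continuousAt.inv₀ h.ne_zero).smul hc.matrix_adjugate.continuousAt

theorem continuousAt_dysonMap (hA : A.IsSymm) (hp : ∀ x, 0 < (p x).im) {m : ι → ℂ}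
    (hm : ∀ x, 0 ≤ (m x).im) : ContinuousAt (dysonMap A J p) m := by
  have h1 : ContinuousAt (fun m : ι → ℂ => resolvent A (fun y => p y + (J : ℂ) ^ 2 * m y)) m :=
    ContinuousAt.comp (f := fun m : ι → ℂ => fun y => p y + (J : ℂ) ^ 2 * m y)
      (continuousAt_resolvent A (isUnit_det_sub_diagonal hA (IsDysonSolution.im_pos hp hm)))
      (continuous_pi fun y => continuous_const.add
        (continuous_const.mul (continuous_apply y))).continuousAt
  rw [continuousAt_pi]
  intro x
  exact continuousAt_pi.mp (continuousAt_pi.mp h1 x) x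

/-- The iterates of the fixed-point map converge to a solution of the Dyson equation. -/
theorem exists_isDysonSolution_tendsto (hJ : 0 < J) (hη : 0 < η) (hA : A.IsSymm)
    (hp : ∀ x, η ≤ (p x).im) :
    ∃ m, IsDysonSolution A J p m ∧
      Filter.Tendsto (fun k => (dysonMap A J p)^[k] 0) Filter.atTop (nhds m) := by
  have hp' : ∀ x, 0 < (p x).im := fun x => hη.trans_le (hp x)
  set s : ℕ → ι → ℂ := fun k => (dysonMap A J p)^[k] 0 with hs
  have hsucc : ∀ k, s (k + 1) = dysonMap A J p (s k) := fun k =>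
    Function.iterate_succ_apply' _ _ _
  have hnn : ∀ k x, 0 ≤ (s k x).im := fun k => by
    induction k with
    | zero => intro x; simp [hs]
    | succ k ih => intro x; rw [hsucc]; exact (dysonMap_im_pos hA hp' ih x).le
  have hpos : ∀ k x, 0 < (s (k + 1) x).im := fun k x => by
    rw [hsucc]; exact dysonMap_im_pos hA hp' (hnn k) x
  have hle : ∀ k x, (s (k + 1) x).im ≤ 1 / η := fun k x => by
    rw [hsucc]; exact dysonMap_im_le hη hA hp (hnn k) x
  set q := J ^ 2 / (J ^ 2 + η ^ 2) with hq
  have hq1 : q < 1 := by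
    rw [hq, div_lt_one (by positivity)]
    have := pow_pos hη 2
    linarith
  have hq0 : 0 ≤ q := by positivity
  -- The comparison starts at iterates 1 and 2: iterate 0 has zero imaginary part, hence lies at
  -- infinite hyperbolic distance.
  obtain ⟨C, hC0, hC⟩ : ∃ C : ℝ, 0 ≤ C ∧
      ∀ x, ‖s 1 x - s 2 x‖ ^ 2 ≤ C ^ 2 * ((s 1 x).im * (s 2 x).im) := by
    refine ⟨∑ x, ‖s 1 x - s 2 x‖ / √((s 1 x).im * (s 2 x).im), by positivity, fun x => ?_⟩
    have hpp : 0 < (s 1 x).im * (s 2 x).im := mul_pos (hpos 0 x) (hpos 1 x)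
    rw [← Real.sq_sqrt hpp.le, ← mul_pow]
    refine pow_le_pow_left₀ (norm_nonneg _) ?_ 2
    rw [← div_le_iff₀ (Real.sqrt_pos.mpr hpp)]
    exact Finset.single_le_sum (f := fun x => ‖s 1 x - s 2 x‖ / √((s 1 x).im * (s 2 x).im))
      (fun y _ => by positivity) (Finset.mem_univ x)
  have hstep : ∀ k x, ‖s (k + 1) x - s (k + 2) x‖ ^ 2 ≤
      (q ^ k * C) ^ 2 * ((s (k + 1) x).im * (s (k + 2) x).im) := fun k => by
    induction k with
    | zero => simpa using hC
    | succ k ih =>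
      intro x
      have := norm_dysonMap_sub_sq_le hJ hη hA hp (hpos k) (hpos (k + 1)) (hle k) (hle (k + 1))
        (by positivity) ih x
      rw [← hsucc, ← hsucc, ← hq, ← mul_assoc q, ← pow_succ'] at this
      exact this
  have hdist : ∀ k, dist (s (k + 1)) (s (k + 1 + 1)) ≤ C / η * q ^ k := fun k => by
    rw [dist_pi_le_iff (by positivity)]
    intro x
    rw [dist_eq_norm]
    refine (sq_le_sq₀ (by positivity) (by positivity)).mp ((hstep k x).trans ?_)
    calc _ ≤ (q ^ k * C) ^ 2 * (1 / η * (1 / η)) := by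
          refine mul_le_mul_of_nonneg_left ?_ (sq_nonneg _)
          exact mul_le_mul (hle k x) (hle (k + 1) x) (hnn _ x) (by positivity)
      _ = _ := by field_simp
  obtain ⟨m, hm⟩ := cauchySeq_tendsto_of_complete
    (cauchySeq_of_le_geometric q (C / η) hq1 hdist)
  have hm0 : Filter.Tendsto s Filter.atTop (nhds m) := (Filter.tendsto_add_atTop_iff_nat 1).mp hm
  -- The limit only inherits Im m ≥ 0. This suffices for continuity of the map at m, because Im p >
  -- 0, and the fixed-point equation then restores strict positivity.
  have hmnn : ∀ x, 0 ≤ (m x).im := fun x =>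
    ge_of_tendsto' ((Complex.continuous_im.tendsto _).comp ((tendsto_pi_nhds.mp hm0) x))
      fun k => hnn k x
  have hfix : m = dysonMap A J p m := by
    refine tendsto_nhds_unique hm ?_
    simp only [hsucc]
    exact (continuousAt_dysonMap hA hp' hmnn).tendsto.comp hm0
  refine ⟨m, ⟨fun x => congrFun hfix x, fun x => ?_⟩, hm0⟩
  rw [hfix]
  exact dysonMap_im_pos hA hp' hmnn x

end Existence

end Dyson

/-! ### Spectral measures of finite symmetric matrices. -/

section SpectralMeasure

variable {V : Type*} [Fintype V] [DecidableEq V]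

theorem exists_orthogonal_eigenvectors {B : Matrix V V ℝ} (hB : B.IsSymm) :
    ∃ (U : V → V → ℝ) (l : V → ℝ), (∀ a c, ∑ j, U a j * U c j = if a = c then 1 else 0) ∧
      ∀ a j, ∑ b, B a b * U b j = l j * U a j := by
  have hH : B.IsHermitian := by
    rw [Matrix.IsHermitian, Matrix.conjTranspose_eq_transpose_of_trivial]
    exact hB
  refine ⟨fun a j => (hH.eigenvectorUnitary : Matrix V V ℝ) a j, hH.eigenvalues,
    fun a c => ?_, fun a j => ?_⟩
  · have h := congrFun (congrFun (Matrix.mem_unitaryGroup_iff.mp hH.eigenvectorUnitary.2) a) c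
    rw [Matrix.mul_apply, Matrix.one_apply] at h
    rw [← h]
    refine Finset.sum_congr rfl fun j _ => ?_
    rw [Matrix.star_apply]
    rfl
  · have h := congrFun (hH.mulVec_eigenvectorBasis j) a
    simpa [Matrix.mulVec, dotProduct] using h

/-- A diagonal entry of the resolvent of a real symmetric matrix is the Stieltjes transform of a
probability measure, whose second moment is the squared norm of the row. -/
theorem exists_spectral_measure {B : Matrix V V ℝ} (hB : B.IsSymm) (r : V) :
    ∃ ν : ProbabilityMeasure ℝ,
      (∀ z : ℂ, 0 < z.im → ∫ s : ℝ, 1 / ((s : ℂ) - z) ∂(ν : Measure ℝ) =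
        resolvent B (fun _ => z) r r) ∧
      ∫⁻ s : ℝ, ENNReal.ofReal (s ^ 2) ∂(ν : Measure ℝ) = ENNReal.ofReal (∑ b, B r b ^ 2) := by
  obtain ⟨U, l, hU, hl⟩ := exists_orthogonal_eigenvectors hB
  -- An atom at each eigenvalue, weighted by the squared r-component of its eigenvector. Its second
  -- moment is the diagonal entry of B² at r.
  let ν : Measure ℝ := ∑ j, ENNReal.ofReal (U r j ^ 2) • Measure.dirac (l j)
  have hprob : IsProbabilityMeasure ν := by
    constructor
    simp only [ν, Measure.coe_finsetSum, Finset.sum_apply, Measure.smul_apply, measure_univ,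
      smul_eq_mul, mul_one]
    rw [← ENNReal.ofReal_sum_of_nonneg fun j _ => sq_nonneg _]
    have := hU r r
    simp only [← sq, if_true] at this
    rw [this, ENNReal.ofReal_one]
  refine ⟨⟨ν, hprob⟩, fun z hz => ?_, ?_⟩
  · change ∫ s : ℝ, 1 / ((s : ℂ) - z) ∂ν = _
    have hne : ∀ j, (l j : ℂ) - z ≠ 0 := fun j h => by
      have := congrArg Complex.im h
      simp at this
      exact hz.ne' this
    rw [integral_finsetSum_measure fun j _ => (integrable_dirac (by simp)).smul_measure (by simp)]
    have hinv : resolvent B (fun _ => z) =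
        Matrix.of fun a c => ∑ j, (U a j : ℂ) * U c j / (l j - z) := by
      refine Matrix.inv_eq_right_inv ?_
      ext a c
      rw [Matrix.mul_apply, Matrix.one_apply]
      have hUc : ∑ j, (U a j : ℂ) * U c j = if a = c then 1 else 0 := by
        have := congrArg (fun x : ℝ => (x : ℂ)) (hU a c)
        push_cast at this
        rw [this]
        split_ifs <;> simp
      have hlc : ∀ j, ∑ b, (B a b : ℂ) * U b j = l j * U a j := fun j => by
        have := congrArg (fun x : ℝ => (x : ℂ)) (hl a j)
        push_cast at this
        exact this
      rw [← hUc]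
      simp only [Matrix.sub_apply, Matrix.map_apply, Matrix.of_apply, sub_mul, Finset.mul_sum,
        Finset.sum_sub_distrib]
      rw [Finset.sum_comm]
      have h2 : ∑ b, ∑ j, Matrix.diagonal (fun _ => z) a b * ((U b j : ℂ) * U c j / (l j - z)) =
          ∑ j, z * ((U a j : ℂ) * U c j / (l j - z)) := by
        rw [Finset.sum_eq_single a]
        · simp
        · intro b _ hb
          simp [Matrix.diagonal_apply_ne' _ hb]
        · simp
      rw [h2, ← Finset.sum_sub_distrib]
      refine Finset.sum_congr rfl fun j _ => ?_
      have h3 : ∑ b, (B a b : ℂ) * ((U b j : ℂ) * U c j / (l j - z)) =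
          (l j * U a j) * (U c j / (l j - z)) := by
        rw [← hlc j, Finset.sum_mul]
        exact Finset.sum_congr rfl fun b _ => by ring
      rw [h3]
      have := hne j
      field_simp
    rw [hinv, Matrix.of_apply]
    refine Finset.sum_congr rfl fun j _ => ?_
    rw [integral_smul_measure, integral_dirac, ENNReal.toReal_ofReal (sq_nonneg _)]
    rw [Complex.real_smul]
    push_cast
    ring
  · change ∫⁻ s : ℝ, ENNReal.ofReal (s ^ 2) ∂ν = _
    simp only [ν, lintegral_finsetSum_measure, lintegral_smul_measure, lintegral_dirac,
      smul_eq_mul]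
    simp_rw [← ENNReal.ofReal_mul (sq_nonneg _)]
    rw [← ENNReal.ofReal_sum_of_nonneg fun j _ => mul_nonneg (sq_nonneg _) (sq_nonneg _)]
    congr 1
    calc ∑ j, U r j ^ 2 * l j ^ 2 = ∑ j, (∑ b, B r b * U b j) * (∑ c, B r c * U c j) :=
          Finset.sum_congr rfl fun j _ => by rw [hl]; ring
      _ = ∑ j, ∑ b, ∑ c, B r b * B r c * (U b j * U c j) := by
          refine Finset.sum_congr rfl fun j _ => ?_
          rw [Finset.sum_mul_sum]
          exact Finset.sum_congr rfl fun b _ => Finset.sum_congr rfl fun c _ => by ring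
      _ = ∑ b, ∑ c, B r b * B r c * ∑ j, (U b j * U c j) := by
          rw [Finset.sum_comm]
          refine Finset.sum_congr rfl fun b _ => ?_
          rw [Finset.sum_comm]
          exact Finset.sum_congr rfl fun c _ => by rw [Finset.mul_sum]
      _ = ∑ b, B r b ^ 2 := by
          simp [hU, sq]

end SpectralMeasure

/-! ### Realizing the iterates by tree-like matrices. -/

section Tree

variable {ι : Type} [Fintype ι] [DecidableEq ι]

/-- The iterates of the Dyson fixed-point map are resolvent entries of finite real symmetric
matrices, obtained by attaching to every site a copy of the previous matrix. -/
theorem exists_matrix_resolvent_eq_iterate {A : Matrix ι ι ℝ} (hA : A.IsSymm) (J : ℝ) (k : ℕ) :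
    ∃ (V : Type) (_ : Fintype V) (_ : DecidableEq V) (B : Matrix V V ℝ) (r : ι → V), B.IsSymm ∧
      (∀ z : ℂ, 0 < z.im → ∀ x, resolvent B (fun _ => z) (r x) (r x) =
        (dysonMap A J fun _ => z)^[k + 1] 0 x) ∧
      ∀ x, ∑ b, B (r x) b ^ 2 ≤ ∑ y, A x y ^ 2 + J ^ 2 := by
  induction k with
  | zero =>
    -- One application of the map to 0 is already the resolvent of A; hence the exponent k + 1.
    refine ⟨ι, inferInstance, inferInstance, A, id, hA, fun z hz x => ?_, fun x => ?_⟩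
    · simp [dysonMap]
    · have := sq_nonneg J
      simp only [id]
      linarith
  | succ k ih =>
    obtain ⟨V, _, _, B, r, hB, hres, -⟩ := ih
    -- `D` is a disjoint union of copies of B, one per site, and `C` joins site x to the root of its
    -- own copy with strength J.
    let C : Matrix ι (ι × V) ℝ := Matrix.of fun x q => if q = (x, r x) then J else 0
    let D : Matrix (ι × V) (ι × V) ℝ :=
      Matrix.of fun q q' => if q.1 = q'.1 then B q.2 q'.2 else 0
    let B' : Matrix (ι ⊕ ι × V) (ι ⊕ ι × V) ℝ := Matrix.fromBlocks A C C.transpose D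
    have hD : D.IsSymm := by
      ext q q'
      simp only [D, Matrix.transpose_apply, Matrix.of_apply, eq_comm (a := q'.1), hB.apply]
    have hB' : B'.IsSymm := Matrix.IsSymm.fromBlocks hA rfl hD
    refine ⟨ι ⊕ ι × V, inferInstance, inferInstance, B', Sum.inl, hB', fun z hz x₀ => ?_,
      fun x => le_of_eq ?_⟩
    · rw [Function.iterate_succ_apply']
      set m := (dysonMap A J fun _ => z)^[k + 1] 0 with hm
      have hmpos : ∀ x, 0 ≤ (m x).im := fun x => by
        rw [hm, ← hres z hz x]
        exact (resolvent_apply_self_im_pos hB (fun _ => hz) (r x)).le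
      have hu := isUnit_det_sub_diagonal hA
        (IsDysonSolution.im_pos (J := J) (p := fun _ => z) (fun _ => hz) hmpos)
      have hG := Matrix.mul_nonsing_inv _ hu
      have hR := Matrix.mul_nonsing_inv _ (isUnit_det_sub_diagonal hB (ω := fun _ => z) fun _ => hz)
      have hu' := isUnit_det_sub_diagonal hB' (ω := fun _ => z) fun _ => hz
      rw [dysonMap]
      change _ * resolvent A (fun y => z + (J : ℂ) ^ 2 * m y) = 1 at hG
      change _ * resolvent B (fun _ => z) = 1 at hR
      set G := resolvent A (fun y => z + (J : ℂ) ^ 2 * m y)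
      have hr : ∀ x, resolvent B (fun _ => z) (r x) (r x) = m x := hres z hz
      set R := resolvent B (fun _ => z)
      have hG' : ∀ x y, ∑ a, (A x a : ℂ) * G a y =
          (if x = y then 1 else 0) + (z + (J : ℂ) ^ 2 * m x) * G x y := fun x y => by
        have := congrFun (congrFun hG x) y
        rw [sub_mul, Matrix.sub_apply, Matrix.diagonal_mul, Matrix.one_apply, Matrix.mul_apply,
          sub_eq_iff_eq_add] at this
        exact this
      have hR' : ∀ x y, ∑ a, (B x a : ℂ) * R a y = (if x = y then 1 else 0) + z * R x y :=
        fun x y => by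
        have := congrFun (congrFun hR x) y
        rw [sub_mul, Matrix.sub_apply, Matrix.diagonal_mul, Matrix.one_apply, Matrix.mul_apply,
          sub_eq_iff_eq_add] at this
        exact this
      -- The x₀ column of the new resolvent, found by Schur complement: eliminating the copy at x
      -- adds J² R(r x, r x) = J² m_x to the spectral parameter there.
      let w : ι ⊕ ι × V → ℂ := Sum.elim (fun x => G x x₀)
        fun q => -((J : ℂ) * G q.1 x₀ * R q.2 (r q.1))
      have hw : (B'.map (fun r : ℝ => (r : ℂ)) - Matrix.diagonal fun _ => z) *ᵥ w =
          Pi.single (Sum.inl x₀) 1 := by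
        rw [Matrix.sub_mulVec]
        ext q
        rw [Pi.sub_apply, Matrix.mulVec_diagonal, Matrix.mulVec, dotProduct, Fintype.sum_sum_type]
        rcases q with x | ⟨y, v⟩
        · have h1 : ∑ q : ι × V, (C x q : ℂ) * -((J : ℂ) * G q.1 x₀ * R q.2 (r q.1)) =
              -((J : ℂ) ^ 2 * m x * G x x₀) := by
            rw [Finset.sum_eq_single (x, r x)]
            · simp only [C, Matrix.of_apply, if_true, hr]
              ring
            · intro q _ hq
              simp [C, hq]
            · simp
          simp only [B', w, Matrix.map_apply, Matrix.fromBlocks_apply₁₁, Sum.elim_inl,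
            Matrix.fromBlocks_apply₁₂, Sum.elim_inr, h1, hG', Pi.single_apply, Sum.inl.injEq]
          ring
        · have h1 : ∑ x, (C x (y, v) : ℂ) * G x x₀ = if v = r y then (J : ℂ) * G y x₀ else 0 := by
            rw [Finset.sum_eq_single y]
            · by_cases hv : v = r y <;> simp [C, hv]
            · intro x _ hx
              simp [C, Prod.ext_iff, hx.symm]
            · simp
          have h2 : ∑ q : ι × V, (D (y, v) q : ℂ) * -((J : ℂ) * G q.1 x₀ * R q.2 (r q.1)) =
              -((J : ℂ) * G y x₀ * ((if v = r y then 1 else 0) + z * R v (r y))) := by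
            rw [← hR', Fintype.sum_prod_type, Finset.sum_eq_single y]
            · simp only [D, Matrix.of_apply, if_true, Finset.mul_sum, ← Finset.sum_neg_distrib]
              exact Finset.sum_congr rfl fun a _ => by ring
            · intro x _ hx
              simp [D, hx.symm]
            · simp
          simp only [B', w, Matrix.map_apply, Matrix.fromBlocks_apply₂₁, Sum.elim_inl,
            Matrix.fromBlocks_apply₂₂, Sum.elim_inr, Matrix.transpose_apply, h1, h2,
            Pi.single_apply, reduceCtorEq, if_false]
          split_ifs <;> ring
      have hw2 := congrArg (fun v => (resolvent B' (fun _ => z)) *ᵥ v) hw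
      simp only [Matrix.mulVec_mulVec] at hw2
      rw [resolvent, Matrix.nonsing_inv_mul _ hu', Matrix.one_mulVec,
        Matrix.mulVec_single_one] at hw2
      exact (congrFun hw2 (Sum.inl x₀)).symm
    -- A new root sees its row of A and a single entry J, so the row norm, and with it the second
    -- moment, does not grow with k.
    · rw [Fintype.sum_sum_type]
      congr 1
      rw [Finset.sum_eq_single (x, r x)]
      · simp [B', C]
      · intro q _ hq
        simp [B', C, hq]
      · simp

end Tree

/-! ### Passing to the limit in the spectral measures. -/

section Limit

/-- Bounded second moments give tightness by Chebyshev. Any weak cluster point will do, since the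
Stieltjes transforms converge along the whole sequence. -/
theorem exists_measure_of_tendsto_stieltjes (ν : ℕ → ProbabilityMeasure ℝ) (C : ℝ)
    (hν : ∀ k, ∫⁻ s : ℝ, ENNReal.ofReal (s ^ 2) ∂(ν k : Measure ℝ) ≤ ENNReal.ofReal C)
    (m : ℂ → ℂ) (hm : ∀ z : ℂ, 0 < z.im → Filter.Tendsto
      (fun k => ∫ s : ℝ, 1 / ((s : ℂ) - z) ∂(ν k : Measure ℝ)) Filter.atTop (nhds (m z))) :
    ∃ μ : Measure ℝ, IsProbabilityMeasure μ ∧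
      (∀ z : ℂ, 0 < z.im → ∫ s : ℝ, 1 / ((s : ℂ) - z) ∂μ = m z) ∧
      Integrable (fun s : ℝ => s ^ 2) μ := by
  have htight : IsTightMeasureSet
      {((μ : ProbabilityMeasure ℝ) : Measure ℝ) | μ ∈ Set.range ν} := by
    rw [isTightMeasureSet_iff_exists_isCompact_measure_compl_le]
    intro ε hε
    obtain ⟨R, hR0, hR⟩ : ∃ R : ℝ, 0 < R ∧ ENNReal.ofReal (C / R ^ 2) ≤ ε := by
      have : Filter.Tendsto (fun R : ℝ => ENNReal.ofReal (C / R ^ 2)) Filter.atTop (nhds 0) := by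
        rw [← ENNReal.ofReal_zero]
        exact (ENNReal.continuous_ofReal.tendsto 0).comp
          (Filter.Tendsto.const_div_atTop (Filter.tendsto_pow_atTop (by norm_num)) C)
      exact ((Filter.eventually_gt_atTop 0).and (this.eventually_le_const hε)).exists
    refine ⟨Metric.closedBall 0 R, isCompact_closedBall 0 R, ?_⟩
    rintro _ ⟨_, ⟨k, rfl⟩, rfl⟩
    refine le_trans ?_ hR
    have h1 := mul_meas_ge_le_lintegral (μ := (ν k : Measure ℝ))
      (f := fun s : ℝ => ENNReal.ofReal (s ^ 2)) (by fun_prop) (ENNReal.ofReal (R ^ 2))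
    rw [ENNReal.ofReal_div_of_pos (by positivity)]
    rw [ENNReal.le_div_iff_mul_le (by left; simp; exact hR0.ne') (by left; simp), mul_comm]
    refine le_trans (mul_le_mul_right (measure_mono fun s hs => ?_) _) (h1.trans (hν k))
    simp only [Set.mem_compl_iff, Metric.mem_closedBall, dist_zero_right, Real.norm_eq_abs,
      not_le] at hs
    refine ENNReal.ofReal_le_ofReal ?_
    rw [← sq_abs s]
    exact pow_le_pow_left₀ hR0.le hs.le 2
  have hcomp := isCompact_closure_of_isTightMeasureSet htight
  obtain ⟨μ, -, hμ⟩ := hcomp.ultrafilter_le_nhds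
    ((Filter.hyperfilter ℕ).map ν) (by
      rw [Filter.le_principal_iff, Ultrafilter.coe_map, Filter.mem_map]
      exact Filter.univ_mem' fun k => subset_closure (Set.mem_range_self k))
  have hμ' : Filter.Tendsto ν (Filter.hyperfilter ℕ) (nhds μ) := hμ
  have hF : (Filter.hyperfilter ℕ : Filter ℕ) ≤ Filter.atTop := Nat.hyperfilter_le_atTop
  refine ⟨μ, inferInstance, fun z hz => ?_, ?_⟩
  · have hne : ∀ s : ℝ, (s : ℂ) - z ≠ 0 := fun s h => by
      have := congrArg Complex.im h
      simp at this
      exact hz.ne' this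
    have hcont : Continuous fun s : ℝ => 1 / ((s : ℂ) - z) :=
      continuous_const.div (by fun_prop) hne
    have hb : ∀ s : ℝ, ‖1 / ((s : ℂ) - z)‖ ≤ 1 / z.im := fun s => by
      rw [norm_div, norm_one]
      refine one_div_le_one_div_of_le hz ?_
      have := Complex.abs_im_le_norm ((s : ℂ) - z)
      simp only [Complex.sub_im, Complex.ofReal_im, zero_sub, abs_neg] at this
      exact (le_abs_self _).trans this
    have h1 := (ProbabilityMeasure.tendsto_iff_forall_integral_rclike_tendsto ℂ).mp hμ'
      (BoundedContinuousFunction.ofNormedAddCommGroup _ hcont _ hb)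
    exact tendsto_nhds_unique h1 ((hm z hz).mono_left hF)
  -- s² is not a bounded test function, so it is truncated at N and recovered by monotone
  -- convergence.
  · have hN : ∀ N : ℕ, ∫⁻ s : ℝ, ENNReal.ofReal (min (s ^ 2) N) ∂(μ : Measure ℝ) ≤
        ENNReal.ofReal C := fun N => by
      have hcont : Continuous fun s : ℝ => min (s ^ 2) (N : ℝ) := by fun_prop
      have hnn : ∀ s : ℝ, 0 ≤ min (s ^ 2) (N : ℝ) := fun s => le_min (sq_nonneg s) (by positivity)
      have hb : ∀ s : ℝ, ‖min (s ^ 2) (N : ℝ)‖ ≤ N := fun s => by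
        rw [Real.norm_of_nonneg (hnn s)]
        exact min_le_right _ _
      have h1 := ProbabilityMeasure.tendsto_iff_forall_integral_tendsto.mp hμ'
        (BoundedContinuousFunction.ofNormedAddCommGroup _ hcont _ hb)
      have hint : ∀ κ : ProbabilityMeasure ℝ,
          Integrable (fun s : ℝ => min (s ^ 2) (N : ℝ)) (κ : Measure ℝ) := fun κ =>
        (BoundedContinuousFunction.ofNormedAddCommGroup _ hcont _ hb).integrable _
      rw [← ofReal_integral_eq_lintegral_ofReal (hint μ) (Filter.Eventually.of_forall hnn)]
      have h2 := (ENNReal.continuous_ofReal.tendsto _).comp h1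
      refine le_of_tendsto' h2 fun k => ?_
      change ENNReal.ofReal (∫ s : ℝ, min (s ^ 2) (N : ℝ) ∂(ν k : Measure ℝ)) ≤ _
      rw [ofReal_integral_eq_lintegral_ofReal (hint (ν k)) (Filter.Eventually.of_forall hnn)]
      exact (lintegral_mono fun s => ENNReal.ofReal_le_ofReal (min_le_left _ _)).trans (hν k)
    have hlim := lintegral_tendsto_of_tendsto_of_monotone (μ := (μ : Measure ℝ))
      (f := fun (N : ℕ) (s : ℝ) => ENNReal.ofReal (min (s ^ 2) N))
      (F := fun s : ℝ => ENNReal.ofReal (s ^ 2)) (fun N => by fun_prop)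
      (Filter.Eventually.of_forall fun s N N' h => ENNReal.ofReal_le_ofReal
        (min_le_min le_rfl (by exact_mod_cast h)))
      (Filter.Eventually.of_forall fun s => by
        obtain ⟨N, hN⟩ := exists_nat_ge (s ^ 2)
        refine tendsto_const_nhds.congr' ?_
        filter_upwards [Filter.eventually_ge_atTop N] with M hM
        rw [min_eq_left (hN.trans (by exact_mod_cast hM))])
    have hle := le_of_tendsto' hlim hN
    refine ⟨by fun_prop, ?_⟩
    rw [hasFiniteIntegral_iff_ofReal (Filter.Eventually.of_forall fun s => sq_nonneg s)]
    exact hle.trans_lt ENNReal.ofReal_lt_top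

/-- Each component of the solution of the Dyson equation is the Stieltjes transform of a
probability measure with finite second moment. -/
theorem exists_measure_stieltjes_isDysonSolution {ι : Type} [Fintype ι] [DecidableEq ι]
    {A : Matrix ι ι ℝ} (hA : A.IsSymm) {J : ℝ} (hJ : 0 < J) (x : ι) :
    ∃ μ : Measure ℝ, IsProbabilityMeasure μ ∧
      (∀ (z : ℂ) (m : ι → ℂ), 0 < z.im → IsDysonSolution A J (fun _ => z) m →
        ∫ s : ℝ, 1 / ((s : ℂ) - z) ∂μ = m x) ∧
      Integrable (fun s : ℝ => s ^ 2) μ := by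
  have hν : ∀ k : ℕ, ∃ ν : ProbabilityMeasure ℝ,
      (∀ z : ℂ, 0 < z.im → ∫ s : ℝ, 1 / ((s : ℂ) - z) ∂(ν : Measure ℝ) =
        (dysonMap A J fun _ => z)^[k + 1] 0 x) ∧
      ∫⁻ s : ℝ, ENNReal.ofReal (s ^ 2) ∂(ν : Measure ℝ) ≤
        ENNReal.ofReal (∑ y, A x y ^ 2 + J ^ 2) := fun k => by
    obtain ⟨V, _, _, B, r, hB, hres, hsq⟩ := exists_matrix_resolvent_eq_iterate hA J k
    obtain ⟨ν, h1, h2⟩ := exists_spectral_measure hB (r x)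
    exact ⟨ν, fun z hz => (h1 z hz).trans (hres z hz x),
      h2.le.trans (ENNReal.ofReal_le_ofReal (hsq x))⟩
  choose ν hν1 hν2 using hν
  have hm : ∀ z : ℂ, ∃ w : ℂ, 0 < z.im →
      (∀ m, IsDysonSolution A J (fun _ => z) m → w = m x) ∧ Filter.Tendsto
        (fun k => ∫ s : ℝ, 1 / ((s : ℂ) - z) ∂(ν k : Measure ℝ)) Filter.atTop (nhds w) :=
    fun z => by
    by_cases hz : 0 < z.im
    · obtain ⟨m, hm, hlim⟩ := exists_isDysonSolution_tendsto (p := fun _ => z) hJ hz hA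
        fun _ => le_rfl
      refine ⟨m x, fun _ => ⟨fun m' hm' => ?_, ?_⟩⟩
      · rw [IsDysonSolution.unique hJ hz hA (fun _ => le_rfl) hm hm']
      · simp only [hν1 _ z hz]
        exact (tendsto_pi_nhds.mp ((Filter.tendsto_add_atTop_iff_nat 1).mpr hlim)) x
    · exact ⟨0, fun h => absurd h hz⟩
  choose w hw using hm
  obtain ⟨μ, h1, h2, h3⟩ := exists_measure_of_tendsto_stieltjes ν _ hν2 w fun z hz => (hw z hz).2
  exact ⟨μ, h1, fun z m hz h => (h2 z hz).trans ((hw z hz).1 m h), h3⟩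

end Limit

/-! ### Stieltjes inversion, uniqueness and density bounds. -/

section StieltjesInversion

open Filter Topology NNReal ENNReal

theorem norm_one_div_sub_le {z : ℂ} (hz : 0 < z.im) (s : ℝ) : ‖1 / ((s : ℂ) - z)‖ ≤ 1 / z.im := by
  rw [norm_div, norm_one]
  refine one_div_le_one_div_of_le hz ?_
  have := Complex.abs_im_le_norm ((s : ℂ) - z)
  simp only [Complex.sub_im, Complex.ofReal_im, zero_sub, abs_neg] at this
  exact (le_abs_self _).trans this

theorem continuous_one_div_sub {z : ℂ} (hz : 0 < z.im) :
    Continuous fun s : ℝ => 1 / ((s : ℂ) - z) :=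
  continuous_const.div (by fun_prop) fun s h => by
    have := congrArg Complex.im h
    simp at this
    exact hz.ne' this

theorem integrable_one_div_sub (μ : Measure ℝ) [IsFiniteMeasure μ] {z : ℂ} (hz : 0 < z.im) :
    Integrable (fun s : ℝ => 1 / ((s : ℂ) - z)) μ :=
  (BoundedContinuousFunction.ofNormedAddCommGroup _ (continuous_one_div_sub hz) _
    (norm_one_div_sub_le hz)).integrable μ

theorem im_one_div_sub (s x η : ℝ) :
    (1 / ((s : ℂ) - (x + η * Complex.I))).im = η / ((s - x) ^ 2 + η ^ 2) := by
  rw [one_div, Complex.inv_im, Complex.normSq_apply]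
  simp
  ring

/-- The imaginary part of the Stieltjes transform is the Poisson integral of the measure. -/
theorem ofReal_im_stieltjes (μ : Measure ℝ) [IsFiniteMeasure μ] (x : ℝ) {η : ℝ} (hη : 0 < η) :
    ENNReal.ofReal (∫ s : ℝ, 1 / ((s : ℂ) - (x + η * Complex.I)) ∂μ).im =
      ∫⁻ s : ℝ, ENNReal.ofReal (η / ((s - x) ^ 2 + η ^ 2)) ∂μ := by
  have hz : 0 < ((x : ℂ) + η * Complex.I).im := by simpa using hη
  have hint := integrable_one_div_sub μ hz
  have h1 : (∫ s : ℝ, 1 / ((s : ℂ) - (x + η * Complex.I)) ∂μ).im =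
      ∫ s : ℝ, (1 / ((s : ℂ) - (x + η * Complex.I))).im ∂μ :=
    (integral_im hint).symm
  rw [h1]
  simp only [im_one_div_sub]
  rw [ofReal_integral_eq_lintegral_ofReal]
  · have := hint.im
    simpa only [RCLike.im_eq_complex_im, im_one_div_sub] using this
  · exact Eventually.of_forall fun s => by positivity

/-- The substitution x = s + ηt moves η out of the kernel and into the test function, so that
dominated convergence applies as η → 0. -/
theorem lintegral_mul_poisson (f : ℝ → ℝ≥0∞) (hf : Measurable f) (s : ℝ) {η : ℝ} (hη : 0 < η) :
    ∫⁻ x : ℝ, f x * ENNReal.ofReal (η / ((s - x) ^ 2 + η ^ 2)) =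
      ∫⁻ t : ℝ, f (s + η * t) * ENNReal.ofReal (1 + t ^ 2)⁻¹ := by
  rw [← lintegral_add_left_eq_self _ s]
  have hm : Measurable fun y : ℝ =>
      f (s + y) * ENNReal.ofReal (η / ((s - (s + y)) ^ 2 + η ^ 2)) := by fun_prop
  conv_lhs => rw [← Real.smul_map_volume_mul_left hη.ne']
  rw [lintegral_smul_measure, lintegral_map hm (by fun_prop), smul_eq_mul,
    ← lintegral_const_mul _ (by fun_prop)]
  refine lintegral_congr fun t => ?_
  rw [abs_of_pos hη, mul_left_comm, ← ENNReal.ofReal_mul hη.le]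
  congr 2
  field_simp
  ring

theorem lintegral_mul_im_stieltjes (μ : Measure ℝ) [IsFiniteMeasure μ] (f : ℝ → ℝ≥0∞)
    (hf : Measurable f) {η : ℝ} (hη : 0 < η) :
    ∫⁻ x : ℝ, f x * ENNReal.ofReal (∫ s : ℝ, 1 / ((s : ℂ) - (x + η * Complex.I)) ∂μ).im =
      ∫⁻ s : ℝ, (∫⁻ t : ℝ, f (s + η * t) * ENNReal.ofReal (1 + t ^ 2)⁻¹) ∂μ := by
  simp only [ofReal_im_stieltjes μ _ hη, ← lintegral_mul_poisson f hf _ hη]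
  rw [lintegral_lintegral_swap (by fun_prop)]
  refine lintegral_congr fun x => ?_
  rw [lintegral_const_mul _ (by fun_prop)]

theorem lintegral_inv_one_add_sq :
    ∫⁻ t : ℝ, ENNReal.ofReal (1 + t ^ 2)⁻¹ = ENNReal.ofReal Real.pi := by
  rw [← integral_univ_inv_one_add_sq, ofReal_integral_eq_lintegral_ofReal integrable_inv_one_add_sq]
  exact Eventually.of_forall fun t => by positivity

/-- Stieltjes inversion, in weak form. -/
theorem tendsto_lintegral_mul_im_stieltjes (μ : Measure ℝ) [IsFiniteMeasure μ]
    (f : BoundedContinuousFunction ℝ ℝ≥0) :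
    Tendsto (fun k : ℕ => ∫⁻ x : ℝ, (f x : ℝ≥0∞) * ENNReal.ofReal
      (∫ s : ℝ, 1 / ((s : ℂ) - (x + (1 / ((k : ℝ) + 1) : ℝ) * Complex.I)) ∂μ).im) atTop
      (𝓝 (ENNReal.ofReal Real.pi * ∫⁻ s, f s ∂μ)) := by
  have hfm : Measurable fun x => (f x : ℝ≥0∞) := by fun_prop
  have hη : ∀ k : ℕ, 0 < 1 / ((k : ℝ) + 1) := fun k => by positivity
  simp only [fun k : ℕ => lintegral_mul_im_stieltjes μ _ hfm (hη k)]
  have hpi := lintegral_inv_one_add_sq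
  obtain ⟨M, hM⟩ : ∃ M : ℝ≥0, ∀ x, f x ≤ M := ⟨nndist f 0, fun x => by
    have h := f.dist_coe_le_dist (g := 0) x
    rw [← NNReal.coe_le_coe, coe_nndist]
    refine le_trans (le_of_eq ?_) h
    simp [NNReal.dist_eq]⟩
  have hinner : ∀ s : ℝ, Tendsto (fun k : ℕ => ∫⁻ t : ℝ,
      (f (s + 1 / ((k : ℝ) + 1) * t) : ℝ≥0∞) * ENNReal.ofReal (1 + t ^ 2)⁻¹) atTop
      (𝓝 (ENNReal.ofReal Real.pi * f s)) := fun s => by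
    have h0 : ENNReal.ofReal Real.pi * f s =
        ∫⁻ t : ℝ, (f s : ℝ≥0∞) * ENNReal.ofReal (1 + t ^ 2)⁻¹ := by
      rw [lintegral_const_mul _ (by fun_prop), hpi, mul_comm]
    rw [h0]
    refine tendsto_lintegral_of_dominated_convergence
      (fun t => (M : ℝ≥0∞) * ENNReal.ofReal (1 + t ^ 2)⁻¹) (fun k => by fun_prop)
      (fun k => Eventually.of_forall fun t => ?_) ?_ (Eventually.of_forall fun t => ?_)
    · exact mul_le_mul_left (ENNReal.coe_le_coe.mpr (hM _)) _
    · rw [lintegral_const_mul _ (by fun_prop), hpi]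
      exact ENNReal.mul_ne_top ENNReal.coe_ne_top ENNReal.ofReal_ne_top
    · refine ENNReal.Tendsto.mul_const ?_ (Or.inr ENNReal.ofReal_ne_top)
      refine (ENNReal.continuous_coe.tendsto _).comp ((f.continuous.tendsto _).comp ?_)
      have := (tendsto_one_div_add_atTop_nhds_zero_nat (𝕜 := ℝ)).mul_const t
      simpa using this.const_add s
  rw [← lintegral_const_mul _ hfm]
  refine tendsto_lintegral_of_dominated_convergence
    (fun _ => (M : ℝ≥0∞) * ENNReal.ofReal Real.pi) (fun k => ?_)
    (fun k => Eventually.of_forall fun s => ?_) ?_ (Eventually.of_forall hinner)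
  · exact Measurable.lintegral_prod_right' (f := fun q : ℝ × ℝ =>
      (f (q.1 + 1 / ((k : ℝ) + 1) * q.2) : ℝ≥0∞) * ENNReal.ofReal (1 + q.2 ^ 2)⁻¹) (by fun_prop)
  · rw [← hpi, ← lintegral_const_mul _ (by fun_prop)]
    exact lintegral_mono fun t => mul_le_mul_left (ENNReal.coe_le_coe.mpr (hM _)) _
  · rw [lintegral_const]
    exact ENNReal.mul_ne_top (ENNReal.mul_ne_top ENNReal.coe_ne_top ENNReal.ofReal_ne_top)
      (measure_ne_top _ _)

/-- A finite measure is determined by its Stieltjes transform. -/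
theorem measure_eq_of_stieltjes_eq {μ ν : Measure ℝ} [IsFiniteMeasure μ] [IsFiniteMeasure ν]
    (h : ∀ z : ℂ, 0 < z.im → ∫ s : ℝ, 1 / ((s : ℂ) - z) ∂μ = ∫ s : ℝ, 1 / ((s : ℂ) - z) ∂ν) :
    μ = ν := by
  refine ext_of_forall_lintegral_eq_of_IsFiniteMeasure fun f => ?_
  have h1 := tendsto_lintegral_mul_im_stieltjes μ f
  have h2 := tendsto_lintegral_mul_im_stieltjes ν f
  have hk : ∀ (k : ℕ) (x : ℝ), 0 < ((x : ℂ) + (1 / ((k : ℝ) + 1) : ℝ) * Complex.I).im :=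
    fun k x => by
      simp only [Complex.add_im, Complex.ofReal_im, Complex.im_ofReal_mul, Complex.I_im]
      positivity
  simp only [fun k x => h _ (hk k x)] at h1
  have h3 := tendsto_nhds_unique h1 h2
  exact (ENNReal.mul_right_inj (by simpa using Real.pi_pos) ENNReal.ofReal_ne_top).mp h3

/-- A finite measure whose Stieltjes transform has bounded imaginary part has bounded density. -/
theorem measure_le_of_im_stieltjes_le {μ : Measure ℝ} [IsFiniteMeasure μ] {C : ℝ}
    (h : ∀ z : ℂ, 0 < z.im → (∫ s : ℝ, 1 / ((s : ℂ) - z) ∂μ).im ≤ C) :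
    μ ≤ ENNReal.ofReal C • volume := by
  have hk : ∀ (k : ℕ) (x : ℝ), 0 < ((x : ℂ) + (1 / ((k : ℝ) + 1) : ℝ) * Complex.I).im :=
    fun k x => by
      simp only [Complex.add_im, Complex.ofReal_im, Complex.im_ofReal_mul, Complex.I_im]
      positivity
  have hf : ∀ f : BoundedContinuousFunction ℝ ℝ≥0,
      ∫⁻ s, f s ∂μ ≤ ENNReal.ofReal C * ∫⁻ s, f s := fun f => by
    have h1 : ENNReal.ofReal Real.pi * ∫⁻ s, f s ∂μ ≤ ENNReal.ofReal C * ∫⁻ s, f s := by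
      refine le_of_tendsto' (tendsto_lintegral_mul_im_stieltjes μ f) fun k => ?_
      rw [← lintegral_const_mul _ (by fun_prop)]
      refine lintegral_mono fun x => ?_
      rw [mul_comm]
      exact mul_le_mul_left (ENNReal.ofReal_le_ofReal (h _ (hk k x))) _
    -- Inversion yields the density bound C/π; only the weaker bound C is kept, using π ≥ 1.
    refine le_trans ?_ h1
    refine le_mul_of_one_le_left' ?_
    rw [ENNReal.one_le_ofReal]
    linarith [Real.pi_gt_three]
  -- Urysohn functions between K and an open U ⊇ K transfer the bound to compact sets; inner
  -- regularity of μ then gives all measurable sets.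
  have hcomp : ∀ K : Set ℝ, IsCompact K → μ K ≤ ENNReal.ofReal C * volume K := fun K hK => by
    have : (ENNReal.ofReal C • (volume : Measure ℝ)).OuterRegular :=
      Measure.OuterRegular.smul _ ENNReal.ofReal_ne_top
    rw [← smul_eq_mul, ← Measure.smul_apply,
      K.measure_eq_iInf_isOpen (ENNReal.ofReal C • volume)]
    refine le_iInf fun U => le_iInf fun hKU => le_iInf fun hU => ?_
    obtain ⟨g, hg1, hg0, -, hg⟩ := exists_continuous_one_zero_of_isCompact hK
      hU.isClosed_compl (Set.disjoint_compl_right_iff_subset.mpr hKU)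
    let f : BoundedContinuousFunction ℝ ℝ≥0 := BoundedContinuousFunction.mkOfBound
      ⟨fun x => (g x).toNNReal, by fun_prop⟩ 1 fun x y => by
        rw [NNReal.dist_eq]
        change |((g x).toNNReal : ℝ) - ((g y).toNNReal : ℝ)| ≤ 1
        rw [Real.coe_toNNReal _ (hg x).1, Real.coe_toNNReal _ (hg y).1, abs_le]
        constructor <;> linarith [(hg x).1, (hg x).2, (hg y).1, (hg y).2]
    have h1 : μ K ≤ ∫⁻ s, f s ∂μ := by
      rw [← lintegral_indicator_one hK.isClosed.measurableSet]
      refine lintegral_mono (Set.indicator_le fun x hx => ?_)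
      change (1 : ℝ≥0∞) ≤ ((g x).toNNReal : ℝ≥0)
      rw [hg1 hx]
      simp
    have h2 : ∫⁻ s, f s ≤ volume U := by
      rw [← lintegral_indicator_one hU.measurableSet]
      refine lintegral_mono fun x => ?_
      by_cases hx : x ∈ U
      · rw [Set.indicator_of_mem hx]
        change (((g x).toNNReal : ℝ≥0) : ℝ≥0∞) ≤ 1
        exact_mod_cast Real.toNNReal_le_one.mpr (hg x).2
      · change (((g x).toNNReal : ℝ≥0) : ℝ≥0∞) ≤ _
        rw [hg0 hx]
        simp
    rw [Measure.smul_apply, smul_eq_mul]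
    exact h1.trans ((hf f).trans (by gcongr))
  refine Measure.le_iff.mpr fun s hs => ?_
  rw [hs.measure_eq_iSup_isCompact μ, Measure.smul_apply, smul_eq_mul]
  refine iSup₂_le fun K hKs => iSup_le fun hK => (hcomp K hK).trans ?_
  gcongr

end StieltjesInversion

/-! ### Integrability of the logarithm. -/

section LogIntegrable

/-- On [-1, 1] the bounded density reduces to Lebesgue integrability of log; outside, log|x| ≤ x².
-/
theorem integrable_log_of_le {μ : Measure ℝ} [IsFiniteMeasure μ] {C : ℝ}
    (h : μ ≤ ENNReal.ofReal C • volume) (h2 : Integrable (fun s : ℝ => s ^ 2) μ) :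
    Integrable (fun x : ℝ => Real.log |x|) μ := by
  simp only [Real.log_abs]
  have hm : Measurable Real.log := Real.measurable_log
  rw [← integrableOn_univ, ← Set.union_compl_self (Set.Icc (-1 : ℝ) 1), integrableOn_union]
  constructor
  · have h1 : IntegrableOn Real.log (Set.Icc (-1) 1) volume := by
      rw [integrableOn_Icc_iff_integrableOn_Ioc, ← intervalIntegrable_iff_integrableOn_Ioc_of_le
        (by norm_num)]
      exact intervalIntegral.intervalIntegrable_log'
    have h3 : IntegrableOn Real.log (Set.Icc (-1) 1) (ENNReal.ofReal C • volume) := by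
      rw [IntegrableOn, Measure.restrict_smul]
      exact h1.integrable.smul_measure ENNReal.ofReal_ne_top
    exact h3.mono_measure h
  · refine Integrable.mono' h2.integrableOn hm.aestronglyMeasurable ?_
    refine (ae_restrict_iff' (by measurability)).mpr (Filter.Eventually.of_forall fun x hx => ?_)
    have hx1 : 1 < |x| := by
      by_contra! hle
      exact hx (abs_le.mp hle)
    rw [← Real.log_abs, Real.norm_of_nonneg (Real.log_nonneg hx1.le), ← sq_abs]
    have := Real.log_le_sub_one_of_pos (by linarith : 0 < |x|)
    nlinarith

end LogIntegrable

/-! ### The log-determinant and stationarity of the free energy. -/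

section Determinant

variable {ι : Type*} [Fintype ι] [DecidableEq ι]

/-- The determinant of `A - diag ω`. -/
noncomputable def detSub (A : Matrix ι ι ℝ) (ω : ι → ℂ) : ℂ :=
  (A.map (fun r : ℝ => (r : ℂ)) - Matrix.diagonal ω).det

theorem differentiable_detSub (A : Matrix ι ι ℝ) : Differentiable ℂ (detSub A) := by
  unfold detSub
  simp only [Matrix.det_apply']
  refine Differentiable.fun_sum fun σ _ => Differentiable.const_mul ?_ _
  have : ∀ i ∈ Finset.univ, Differentiable ℂ fun ω : ι → ℂ =>
      (A.map (fun r : ℝ => (r : ℂ)) - Matrix.diagonal ω) (σ i) i := fun i _ => by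
    simp only [Matrix.sub_apply, Matrix.diagonal_apply]
    split_ifs
    · exact (differentiable_const _).sub (differentiable_apply _)
    · exact differentiable_const _
  exact fun ω => (HasFDerivAt.finsetProd (u := Finset.univ) fun i hi => (this i hi ω).hasFDerivAt).differentiableAt


/-- Only row i changes, so the determinant is affine in t, with slope minus the (i, i) cofactor,
that is, minus det times the resolvent entry. -/
theorem detSub_add_single (A : Matrix ι ι ℝ) {ω : ι → ℂ} (h : detSub A ω ≠ 0) (i : ι) (t : ℂ) :
    detSub A (ω + t • Pi.single i 1) = detSub A ω * (1 - t * resolvent A ω i i) := by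
  set M := A.map (fun r : ℝ => (r : ℂ)) - Matrix.diagonal ω with hM
  have h1 : A.map (fun r : ℝ => (r : ℂ)) - Matrix.diagonal (ω + t • Pi.single i 1) =
      M.updateRow i (M i + (-t) • Pi.single i 1) := by
    ext a b
    by_cases ha : a = i
    · subst ha
      by_cases hb : a = b
      · subst hb
        simp [hM]
        ring
      · simp [hM, hb, Ne.symm hb]
    · rw [Matrix.updateRow_ne ha]
      by_cases hb : a = b
      · subst hb
        simp [hM, ha]
      · simp [hM, hb]
  have h2 : resolvent A ω i i = (detSub A ω)⁻¹ * M.adjugate i i := by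
    rw [resolvent, Matrix.inv_def, Ring.inverse_eq_inv']
    rfl
  rw [h2, detSub, h1, Matrix.det_updateRow_add, Matrix.det_updateRow_smul, Matrix.updateRow_eq_self,
    ← Matrix.adjugate_apply]
  change detSub A ω + _ = _
  field_simp
  ring

theorem fderiv_detSub (A : Matrix ι ι ℝ) {ω : ι → ℂ} (h : detSub A ω ≠ 0) (δ : ι → ℂ) :
    fderiv ℂ (detSub A) ω δ = -(detSub A ω * ∑ i, resolvent A ω i i * δ i) := by
  have hs : ∀ i, fderiv ℂ (detSub A) ω (Pi.single i 1) = -(detSub A ω * resolvent A ω i i) :=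
    fun i => by
    have h1 : HasDerivAt (fun t : ℂ => detSub A (ω + t • Pi.single i 1))
        (fderiv ℂ (detSub A) ω (Pi.single i 1)) 0 :=
      ((differentiable_detSub A ω).hasFDerivAt).hasLineDerivAt _
    simp only [detSub_add_single A h] at h1
    have h2 : HasDerivAt (fun t : ℂ => detSub A ω * (1 - t * resolvent A ω i i))
        (detSub A ω * (0 - 1 * resolvent A ω i i)) 0 :=
      (((hasDerivAt_const _ _).sub ((hasDerivAt_id _).mul_const _))).const_mul _
    rw [h1.unique h2]
    ring
  conv_lhs => rw [pi_eq_sum_univ' δ]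
  rw [map_sum, Finset.mul_sum, ← Finset.sum_neg_distrib]
  refine Finset.sum_congr rfl fun i _ => ?_
  rw [map_smul, hs, smul_eq_mul]
  ring

theorem hasFDerivAt_log_norm_detSub (A : Matrix ι ι ℝ) {ω : ι → ℂ} (h : detSub A ω ≠ 0) :
    ∃ L : (ι → ℂ) →L[ℝ] ℝ, HasFDerivAt (fun ω => Real.log ‖detSub A ω‖) L ω ∧
      ∀ δ, L δ = -(∑ i, resolvent A ω i i * δ i).re := by
  -- Dividing by the value at ω puts the base point at 1, where the principal logarithm is
  -- differentiable; its real part is log of the norm up to a constant.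
  have h1 : HasFDerivAt (fun ω' => detSub A ω' * (detSub A ω)⁻¹)
      ((detSub A ω)⁻¹ • fderiv ℂ (detSub A) ω) ω :=
    (differentiable_detSub A ω).hasFDerivAt.mul_const _
  have h2 := h1.clog (by rw [mul_inv_cancel₀ h]; exact Complex.one_mem_slitPlane)
  have h3 := (Complex.reCLM.hasFDerivAt.comp ω (h2.restrictScalars ℝ)).add_const
    (Real.log ‖detSub A ω‖)
  refine ⟨_, h3.congr_of_eventuallyEq ?_, fun δ => ?_⟩
  · have hne : ∀ᶠ ω' in nhds ω, detSub A ω' ≠ 0 :=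
      (differentiable_detSub A).continuous.continuousAt.eventually_ne h
    filter_upwards [hne] with ω' hω'
    simp only [Function.comp_apply, Complex.reCLM_apply, Complex.log_re, norm_mul, norm_inv]
    rw [Real.log_mul (norm_ne_zero_iff.mpr hω') (inv_ne_zero (norm_ne_zero_iff.mpr h)),
      Real.log_inv]
    ring
  · simp only [ContinuousLinearMap.comp_apply, ContinuousLinearMap.coe_restrictScalars',
      _root_.smul_apply, fderiv_detSub A h, Complex.reCLM_apply, smul_eq_mul,
      mul_inv_cancel₀ h]
    rw [← Complex.neg_re]
    congr 1
    field_simp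

/-- The free energy functional of the Dyson equation, evaluated at `m`. -/
noncomputable def freeEnergy (A : Matrix ι ι ℝ) (J : ℝ) (p m : ι → ℂ) : ℝ :=
  Real.log ‖detSub A (fun x => p x + (J : ℂ) ^ 2 * m x)‖ + J ^ 2 / 2 * (∑ x, m x ^ 2).re

/-- Since the free energy is stationary in `m` at solutions, its derivative along a curve of
solutions only involves the derivative of the spectral parameter. -/
theorem hasDerivAt_freeEnergy {A : Matrix ι ι ℝ} (hA : A.IsSymm) {J η : ℝ} (hJ : 0 < J)
    (hη : 0 < η) {p m : ℝ → ι → ℂ} {t₀ : ℝ} {p' : ι → ℂ} (hp' : HasDerivAt p p' t₀)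
    (hp : ∀ᶠ t in nhds t₀, ∀ x, η ≤ (p t x).im)
    (hm : ∀ᶠ t in nhds t₀, IsDysonSolution A J (p t) (m t)) :
    HasDerivAt (fun t => freeEnergy A J (p t) (m t)) (-(∑ x, m t₀ x * p' x).re) t₀ := by
  have hp₀ := hp.self_of_nhds
  have hm₀ := hm.self_of_nhds
  let ω : ℝ → ι → ℂ := fun t x => p t x + (J : ℂ) ^ 2 * m t x
  have hJ' : (J : ℂ) ≠ 0 := Complex.ofReal_ne_zero.mpr hJ.ne'
  have hdet : detSub A (ω t₀) ≠ 0 := (isUnit_det_sub_diagonal hA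
    (IsDysonSolution.im_pos (fun x => hη.trans_le (hp₀ x)) fun x => (hm₀.2 x).le)).ne_zero
  obtain ⟨L, hL, hL'⟩ := hasFDerivAt_log_norm_detSub A hdet
  -- p and ω become independent variables: since m = (ω - p)/J², the quadratic term is Re ∑ (ω - p)²
  -- / (2J²).
  let Q : (ι → ℂ) × (ι → ℂ) → ℂ := fun q => ∑ x, (q.2 x - q.1 x) ^ 2
  let Φ : (ι → ℂ) × (ι → ℂ) → ℝ := fun q =>
    Real.log ‖detSub A q.2‖ + 1 / (2 * J ^ 2) * (Q q).re
  have hQ : HasFDerivAt Q (∑ x, (2 * (ω t₀ x - p t₀ x)) •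
      ((ContinuousLinearMap.proj x).comp (ContinuousLinearMap.snd ℝ (ι → ℂ) (ι → ℂ)) -
        (ContinuousLinearMap.proj x).comp (ContinuousLinearMap.fst ℝ (ι → ℂ) (ι → ℂ))))
      (p t₀, ω t₀) := by
    refine HasFDerivAt.fun_sum fun x _ => ?_
    have h1 : HasFDerivAt (fun q : (ι → ℂ) × (ι → ℂ) => q.2 x - q.1 x)
        ((ContinuousLinearMap.proj x).comp (ContinuousLinearMap.snd ℝ (ι → ℂ) (ι → ℂ)) -
        (ContinuousLinearMap.proj x).comp (ContinuousLinearMap.fst ℝ (ι → ℂ) (ι → ℂ)))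
        (p t₀, ω t₀) := ContinuousLinearMap.hasFDerivAt (F := ℂ)
        ((ContinuousLinearMap.proj x).comp (ContinuousLinearMap.snd ℝ (ι → ℂ) (ι → ℂ)) -
        (ContinuousLinearMap.proj x).comp (ContinuousLinearMap.fst ℝ (ι → ℂ) (ι → ℂ)))
    simpa using h1.pow 2
  have hΦ := (hL.comp (p t₀, ω t₀) hasFDerivAt_snd).add
    ((Complex.reCLM.hasFDerivAt.comp (p t₀, ω t₀) hQ).const_mul (1 / (2 * J ^ 2)))
  set Φ' := L.comp (ContinuousLinearMap.snd ℝ (ι → ℂ) (ι → ℂ)) + (1 / (2 * J ^ 2)) •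
    Complex.reCLM.comp (∑ x, (2 * (ω t₀ x - p t₀ x)) •
      ((ContinuousLinearMap.proj x).comp (ContinuousLinearMap.snd ℝ (ι → ℂ) (ι → ℂ)) -
        (ContinuousLinearMap.proj x).comp (ContinuousLinearMap.fst ℝ (ι → ℂ) (ι → ℂ)))) with hΦ'
  have hres : ∀ x, resolvent A (ω t₀) x x = m t₀ x := fun x => (hm₀.1 x).symm
  -- Stationarity: the ω-part of the derivative cancels exactly because m_x = G_xx.
  have hval : ∀ q, Φ' q = -(∑ x, m t₀ x * q.1 x).re := fun q => by
    have : ∀ x, ω t₀ x - p t₀ x = (J : ℂ) ^ 2 * m t₀ x := fun x => add_sub_cancel_left _ _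
    have h2 : ∑ x, 2 * ((J : ℂ) ^ 2 * m t₀ x) * (q.2 x - q.1 x) =
        ((2 * J ^ 2 : ℝ) : ℂ) * ∑ x, m t₀ x * (q.2 x - q.1 x) := by
      rw [Finset.mul_sum]
      push_cast
      exact Finset.sum_congr rfl fun x _ => by ring
    simp only [hΦ', _root_.add_apply, ContinuousLinearMap.comp_apply, hL', hres,
      _root_.smul_apply, _root_.sum_apply, this,
      _root_.sub_apply, ContinuousLinearMap.proj_apply, smul_eq_mul,
      ContinuousLinearMap.coe_fst', ContinuousLinearMap.coe_snd', Complex.reCLM_apply, h2,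
      Complex.re_ofReal_mul]
    have : (2 * J ^ 2 : ℝ) ≠ 0 := by positivity
    rw [one_div, inv_mul_cancel_left₀ this]
    simp only [mul_sub, Finset.sum_sub_distrib, Complex.sub_re]
    ring
  -- Differentiability of ω in t is never needed. As the derivative of Φ ignores ω, the Lipschitz
  -- bound from stability suffices to control the remainder.
  have hlip : (fun t => ω t - ω t₀) =O[nhds t₀] fun t => p t - p t₀ := by
    set r := η / (J + η)
    have hr : 0 < r := by positivity
    refine Asymptotics.IsBigO.of_bound (√(Fintype.card ι) / r) ?_
    filter_upwards [hp, hm] with t hpt hmt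
    rw [pi_norm_le_iff_of_nonneg (by positivity)]
    intro x
    refine (sq_le_sq₀ (by positivity) (by positivity)).mp ?_
    have h1 := IsDysonSolution.sum_norm_sq_sub_le hJ hη hA hpt hp₀ hmt hm₀
    have h2 : ∑ x, ‖p t x - p t₀ x‖ ^ 2 ≤ Fintype.card ι * ‖p t - p t₀‖ ^ 2 := by
      rw [← nsmul_eq_mul]
      refine Finset.sum_le_card_nsmul _ _ _ fun y _ => ?_
      exact pow_le_pow_left₀ (norm_nonneg _) (norm_le_pi_norm (p t - p t₀) y) 2
    have h3 := Finset.single_le_sum (f := fun x => ‖ω t x - ω t₀ x‖ ^ 2)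
      (fun _ _ => sq_nonneg _) (Finset.mem_univ x)
    rw [mul_pow, div_pow, Real.sq_sqrt (by positivity), div_mul_eq_mul_div,
      le_div_iff₀ (by positivity), mul_comm]
    exact (mul_le_mul_of_nonneg_left h3 (sq_nonneg r)).trans (h1.trans h2)
  have hpO : (fun t => p t - p t₀) =O[nhds t₀] fun t => t - t₀ := hp'.isBigO_sub
  have hcont : Filter.Tendsto (fun t => (p t, ω t)) (nhds t₀) (nhds (p t₀, ω t₀)) := by
    refine hp'.continuousAt.tendsto.prodMk_nhds ?_
    have h0 : Filter.Tendsto (fun t => p t - p t₀) (nhds t₀) (nhds 0) := by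
      simpa using hp'.continuousAt.tendsto.sub_const (p t₀)
    have := (hlip.trans_tendsto h0).add_const (ω t₀)
    simpa using this
  have hlittle := (hΦ.isLittleO.comp_tendsto hcont).trans_isBigO
    ((hpO.prod_left (hlip.trans hpO)) : (fun t => (p t - p t₀, ω t - ω t₀)) =O[nhds t₀] _)
  have hlin : HasDerivAt (fun t => -(∑ x, m t₀ x * (p t x - p t₀ x)).re)
      (-(∑ x, m t₀ x * p' x).re) t₀ := by
    have h1 : HasDerivAt (fun t => ∑ x, m t₀ x * (p t x - p t₀ x)) (∑ x, m t₀ x * p' x) t₀ :=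
      HasDerivAt.fun_sum fun x _ => ((hasDerivAt_pi.mp hp' x).sub_const _).const_mul _
    exact (Complex.reCLM.hasFDerivAt.comp_hasDerivAt t₀ h1).neg
  have hW : ∀ t, freeEnergy A J (p t) (m t) = Φ (p t, ω t) := fun t => by
    have : ∀ x, (ω t x - p t x) ^ 2 = ((J ^ 4 : ℝ) : ℂ) * m t x ^ 2 := fun x => by
      have : ω t x - p t x = (J : ℂ) ^ 2 * m t x := add_sub_cancel_left _ _
      rw [this]
      push_cast
      ring
    simp only [freeEnergy, Φ, Q, this, ← Finset.mul_sum, Complex.re_ofReal_mul]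
    congr 1
    field_simp
  simp only [hW]
  rw [hasDerivAt_iff_isLittleO] at hlin ⊢
  refine (hlittle.add hlin).congr_left fun t => ?_
  have h0 : -(∑ x, m t₀ x * (p t₀ x - p t₀ x)).re = 0 := by simp
  have h1 : Φ' ((p t, ω t) - (p t₀, ω t₀)) = -(∑ x, m t₀ x * (p t x - p t₀ x)).re := hval _
  rw [h0, sub_zero]
  change Φ (p t, ω t) - Φ (p t₀, ω t₀) - Φ' ((p t, ω t) - (p t₀, ω t₀)) + (_ - _) =
    Φ (p t, ω t) - Φ (p t₀, ω t₀) - _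
  rw [h1]
  ring

end Determinant

/-! ### The regularized logarithmic potential. -/

section LogPotential

open Filter Topology

theorem log_sq_add_sq_nonneg_sub (s : ℝ) {η : ℝ} (hη : 0 < η) :
    0 ≤ Real.log (s ^ 2 + η ^ 2) / 2 - Real.log η ∧
      Real.log (s ^ 2 + η ^ 2) / 2 - Real.log η ≤ s ^ 2 / (2 * η ^ 2) := by
  have h1 : Real.log (s ^ 2 + η ^ 2) / 2 - Real.log η = Real.log (s ^ 2 / η ^ 2 + 1) / 2 := by
    have : s ^ 2 + η ^ 2 = (s ^ 2 / η ^ 2 + 1) * η ^ 2 := by field_simp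
    rw [this, Real.log_mul (by positivity) (by positivity), Real.log_pow]
    push_cast
    ring
  rw [h1]
  constructor
  · have := Real.log_nonneg (by linarith [show 0 ≤ s ^ 2 / η ^ 2 by positivity] :
      1 ≤ s ^ 2 / η ^ 2 + 1)
    linarith
  · have := Real.log_le_sub_one_of_pos (by positivity : 0 < s ^ 2 / η ^ 2 + 1)
    calc _ ≤ (s ^ 2 / η ^ 2) / 2 := by linarith
      _ = _ := by field_simp

theorem measurable_log_sq_add_sq (η : ℝ) :
    Measurable fun s : ℝ => Real.log (s ^ 2 + η ^ 2) / 2 :=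
  (Real.measurable_log.comp ((measurable_id.pow_const 2).add_const _)).div_const 2

variable {μ : Measure ℝ} [IsProbabilityMeasure μ]

theorem integrable_log_sq_add_sq (h2 : Integrable (fun s : ℝ => s ^ 2) μ) {η : ℝ} (hη : 0 < η) :
    Integrable (fun s : ℝ => Real.log (s ^ 2 + η ^ 2) / 2) μ := by
  have h3 : Integrable (fun s : ℝ => Real.log (s ^ 2 + η ^ 2) / 2 - Real.log η) μ := by
    refine Integrable.mono' (h2.div_const (2 * η ^ 2))
      ((measurable_log_sq_add_sq η).sub_const _).aestronglyMeasurable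
      (Eventually.of_forall fun s => ?_)
    obtain ⟨ha, hb⟩ := log_sq_add_sq_nonneg_sub s hη
    rwa [Real.norm_of_nonneg ha]
  refine (h3.add (integrable_const (Real.log η))).congr (Eventually.of_forall fun s => ?_)
  simp

theorem hasDerivAt_integral_log_sq_add_sq (h2 : Integrable (fun s : ℝ => s ^ 2) μ) {η : ℝ}
    (hη : 0 < η) :
    HasDerivAt (fun η : ℝ => ∫ s : ℝ, Real.log (s ^ 2 + η ^ 2) / 2 ∂μ)
      (∫ s : ℝ, 1 / ((s : ℂ) - η * Complex.I) ∂μ).im η := by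
  have him : (∫ s : ℝ, 1 / ((s : ℂ) - η * Complex.I) ∂μ).im =
      ∫ s : ℝ, η / (s ^ 2 + η ^ 2) ∂μ := by
    have h1 := integral_im (integrable_one_div_sub μ (z := η * Complex.I) (by simpa using hη))
    simp only [RCLike.im_eq_complex_im] at h1
    rw [← h1]
    refine integral_congr_ae (Eventually.of_forall fun s => ?_)
    simpa using im_one_div_sub s 0 η
  rw [him]
  -- For y > η/2 the integrand y/(s²+y²) is at most 1/y < 2/η, uniformly in s.
  refine (hasDerivAt_integral_of_dominated_loc_of_deriv_le (μ := μ)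
    (F := fun (η s : ℝ) => Real.log (s ^ 2 + η ^ 2) / 2)
    (F' := fun (η s : ℝ) => η / (s ^ 2 + η ^ 2)) (bound := fun _ => 2 / η)
    (Ioi_mem_nhds (half_lt_self hη)) (Eventually.of_forall fun η =>
      (measurable_log_sq_add_sq η).aestronglyMeasurable)
    (integrable_log_sq_add_sq h2 hη)
    (Measurable.aestronglyMeasurable (by fun_prop)) (Eventually.of_forall fun s y hy => ?_)
    (integrable_const _) (Eventually.of_forall fun s y hy => ?_)).2
  · have hy0 : 0 < y := (half_pos hη).trans hy
    rw [Real.norm_of_nonneg (by positivity), div_le_div_iff₀ (by positivity) hη]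
    have : η / 2 < y := hy
    nlinarith [sq_nonneg s]
  · have hy0 : 0 < y := (half_pos hη).trans hy
    have h1 : HasDerivAt (fun y : ℝ => s ^ 2 + y ^ 2) (2 * y) y := by
      simpa using (hasDerivAt_pow 2 y).const_add (s ^ 2)
    have h3 := (h1.log (by positivity)).div_const 2
    convert! h3 using 1
    field_simp

theorem tendsto_integral_log_sq_add_sq_sub (h2 : Integrable (fun s : ℝ => s ^ 2) μ) :
    Tendsto (fun η : ℝ => ∫ s : ℝ, Real.log (s ^ 2 + η ^ 2) / 2 ∂μ - Real.log η) atTop (𝓝 0) := by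
  have hlim : Tendsto (fun η : ℝ => (∫ s : ℝ, s ^ 2 ∂μ) / (2 * η ^ 2)) atTop (𝓝 0) :=
    Tendsto.const_div_atTop (Tendsto.const_mul_atTop (by norm_num)
      (tendsto_pow_atTop (by norm_num))) _
  have hsub : ∀ η : ℝ, 0 < η → ∫ s : ℝ, Real.log (s ^ 2 + η ^ 2) / 2 ∂μ - Real.log η =
      ∫ s : ℝ, (Real.log (s ^ 2 + η ^ 2) / 2 - Real.log η) ∂μ := fun η hη => by
    rw [integral_sub (integrable_log_sq_add_sq h2 hη) (integrable_const _)]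
    simp
  refine tendsto_of_tendsto_of_tendsto_of_le_of_le' tendsto_const_nhds hlim ?_ ?_
  · filter_upwards [eventually_gt_atTop 0] with η hη
    rw [hsub η hη]
    exact integral_nonneg fun s => (log_sq_add_sq_nonneg_sub s hη).1
  · filter_upwards [eventually_gt_atTop 0] with η hη
    rw [hsub η hη, ← integral_div]
    exact integral_mono ((integrable_log_sq_add_sq h2 hη).sub (integrable_const _))
      (h2.div_const _) fun s => (log_sq_add_sq_nonneg_sub s hη).2

-- Dominated convergence: for η ≤ 1 the integrand lies between log|s| and s²/2. Absolute continuity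
-- discards s = 0, where `Real.log` has the default value 0.
omit [IsProbabilityMeasure μ] in
theorem tendsto_integral_log_sq_add_sq_zero (h2 : Integrable (fun s : ℝ => s ^ 2) μ)
    (hac : μ ≪ volume) (hlog : Integrable (fun s : ℝ => Real.log |s|) μ) :
    Tendsto (fun k : ℕ => ∫ s : ℝ, Real.log (s ^ 2 + (1 / ((k : ℝ) + 1)) ^ 2) / 2 ∂μ) atTop
      (𝓝 (∫ s : ℝ, Real.log |s| ∂μ)) := by
  have hne : ∀ᵐ s ∂μ, s ≠ 0 := hac.ae_le (Measure.ae_ne volume 0)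
  have hlog2 : ∀ s : ℝ, Real.log (s ^ 2) / 2 = Real.log |s| := fun s => by
    rw [Real.log_pow, Real.log_abs]
    push_cast
    ring
  refine tendsto_integral_of_dominated_convergence (fun s => |(Real.log |s|)| + s ^ 2)
    (fun k => (measurable_log_sq_add_sq _).aestronglyMeasurable) (hlog.abs.add h2) (fun k => ?_) ?_
  · filter_upwards [hne] with s hs
    have hη1 : (1 / ((k : ℝ) + 1)) ^ 2 ≤ 1 := by
      refine pow_le_one₀ (by positivity) ?_
      rw [div_le_one (by positivity)]
      linarith [show (0 : ℝ) ≤ k by positivity]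
    have hs2 : 0 < s ^ 2 := by positivity
    have ha : Real.log |s| ≤ Real.log (s ^ 2 + (1 / ((k : ℝ) + 1)) ^ 2) / 2 := by
      rw [← hlog2]
      have := Real.log_le_log hs2 (by linarith [sq_nonneg (1 / ((k : ℝ) + 1))] :
        s ^ 2 ≤ s ^ 2 + (1 / ((k : ℝ) + 1)) ^ 2)
      linarith
    have hb := Real.log_le_sub_one_of_pos
      (by positivity : 0 < s ^ 2 + (1 / ((k : ℝ) + 1)) ^ 2)
    rw [Real.norm_eq_abs, abs_le]
    constructor
    · linarith [neg_abs_le (Real.log |s|)]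
    · linarith [abs_nonneg (Real.log |s|)]
  · filter_upwards [hne] with s hs
    rw [← hlog2]
    refine Tendsto.div_const ?_ 2
    refine (Real.continuousAt_log (pow_ne_zero 2 hs)).tendsto.comp ?_
    have := ((tendsto_one_div_add_atTop_nhds_zero_nat (𝕜 := ℝ)).pow 2).const_add (s ^ 2)
    simpa using this

end LogPotential

/-! ### Free energy as log potential, and its concavity. -/

section FreeEnergy

open Filter Topology

variable {ι : Type*} [Fintype ι] [DecidableEq ι] {A : Matrix ι ι ℝ} {J : ℝ}

theorem tendsto_freeEnergy_sub_log (hA : A.IsSymm) {m : ℝ → ι → ℂ}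
    (hm : ∀ η : ℝ, 0 < η → IsDysonSolution A J (fun _ => η * Complex.I) (m η)) :
    Tendsto (fun η : ℝ => freeEnergy A J (fun _ => η * Complex.I) (m η) -
      Fintype.card ι * Real.log η) atTop (𝓝 0) := by
  have hp : ∀ η : ℝ, ∀ _ : ι, η ≤ (η * Complex.I).im := fun η _ => by simp
  have hm0 : ∀ x, Tendsto (fun η => m η x) atTop (𝓝 0) := fun x => by
    refine squeeze_zero_norm' (a := fun η : ℝ => 1 / η) ?_
      (tendsto_const_nhds.div_atTop tendsto_id)
    filter_upwards [eventually_gt_atTop 0] with η hη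
    exact IsDysonSolution.norm_le_inv hη hA (hp η) (hm η hη) x
  -- Factoring -iη out of A - diag ω leaves X, which tends to 1; the scalar contributes the term
  -- card · log η.
  let X : ℝ → Matrix ι ι ℂ := fun η => 1 + (Complex.I * ((η⁻¹ : ℝ) : ℂ)) •
    (A.map (fun r : ℝ => (r : ℂ)) - Matrix.diagonal fun x => (J : ℂ) ^ 2 * m η x)
  have hX : Tendsto X atTop (𝓝 1) := by
    have h1 : Tendsto (fun η : ℝ => Complex.I * ((η⁻¹ : ℝ) : ℂ)) atTop (𝓝 0) := by
      have := ((Complex.continuous_ofReal.tendsto 0).comp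
        (tendsto_inv_atTop_zero (𝕜 := ℝ))).const_mul Complex.I
      simpa using this
    have h2 : Tendsto (fun η : ℝ => fun x => (J : ℂ) ^ 2 * m η x) atTop (𝓝 0) := by
      rw [tendsto_pi_nhds]
      intro x
      simpa using (hm0 x).const_mul ((J : ℂ) ^ 2)
    have h3 : Tendsto (fun η : ℝ => Matrix.diagonal fun x => (J : ℂ) ^ 2 * m η x) atTop
        (𝓝 (Matrix.diagonal (0 : ι → ℂ))) :=
      ((Continuous.matrix_diagonal continuous_id).tendsto (0 : ι → ℂ)).comp h2
    have h4 := (h1.smul (h3.const_sub (A.map (fun r : ℝ => (r : ℂ))))).const_add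
      (1 : Matrix ι ι ℂ)
    simp only [zero_smul, add_zero] at h4
    exact h4
  have hdet : Tendsto (fun η => Real.log ‖(X η).det‖) atTop (𝓝 0) := by
    have h1 : Tendsto (fun η => ‖(X η).det‖) atTop (𝓝 1) := by
      have hc : Continuous fun M : Matrix ι ι ℂ => ‖M.det‖ :=
        (Continuous.matrix_det continuous_id).norm
      have := (hc.tendsto 1).comp hX
      simp only [Matrix.det_one, norm_one] at this
      exact this
    have := (Real.continuousAt_log one_ne_zero).tendsto.comp h1
    rw [Real.log_one] at this
    exact this
  have hsq : Tendsto (fun η => J ^ 2 / 2 * (∑ x, m η x ^ 2).re) atTop (𝓝 0) := by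
    have h1 : Tendsto (fun η => ∑ x, m η x ^ 2) atTop (𝓝 (∑ _ : ι, (0 : ℂ) ^ 2)) :=
      tendsto_finsetSum _ fun x _ => (hm0 x).pow 2
    have := ((Complex.continuous_re.tendsto _).comp h1).const_mul (J ^ 2 / 2)
    simpa using this
  have hsum := hdet.add hsq
  rw [add_zero] at hsum
  refine hsum.congr' ?_
  have hdet_ne : ∀ᶠ M : Matrix ι ι ℂ in 𝓝 1, M.det ≠ 0 :=
    (Continuous.matrix_det continuous_id).continuousAt.eventually_ne (by simp)
  filter_upwards [eventually_gt_atTop 0, hX.eventually hdet_ne] with η hη hXη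
  have hηC : (η : ℂ) ≠ 0 := Complex.ofReal_ne_zero.mpr hη.ne'
  have h1 : A.map (fun r : ℝ => (r : ℂ)) -
      Matrix.diagonal (fun x => η * Complex.I + (J : ℂ) ^ 2 * m η x) =
      (-((η : ℂ) * Complex.I)) • X η := by
    have h2 : Matrix.diagonal (fun x => η * Complex.I + (J : ℂ) ^ 2 * m η x) =
        ((η : ℂ) * Complex.I) • (1 : Matrix ι ι ℂ) +
          Matrix.diagonal fun x => (J : ℂ) ^ 2 * m η x := by
      rw [Matrix.smul_one_eq_diagonal, Matrix.diagonal_add]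
    rw [h2, smul_add, smul_smul, Complex.ofReal_inv]
    have h3 : -((η : ℂ) * Complex.I) * (Complex.I * (η : ℂ)⁻¹) = 1 := by
      field_simp
      simp
    rw [h3, one_smul, neg_smul]
    abel
  rw [freeEnergy, detSub, h1, Matrix.det_smul, norm_mul, norm_pow, norm_neg, norm_mul,
    Complex.norm_I, mul_one, Complex.norm_real, Real.norm_of_nonneg hη.le,
    Real.log_mul (by positivity) (norm_ne_zero_iff.mpr hXη), Real.log_pow]
  ring

/-- On the imaginary axis the free energy is the logarithmic potential. -/
theorem card_mul_integral_log_eq_freeEnergy (hA : A.IsSymm) (hJ : 0 < J) {μ : Measure ℝ}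
    [IsProbabilityMeasure μ] (h2 : Integrable (fun s : ℝ => s ^ 2) μ) {m : ℝ → ι → ℂ}
    (hm : ∀ η : ℝ, 0 < η → IsDysonSolution A J (fun _ => η * Complex.I) (m η))
    (hμ : ∀ η : ℝ, 0 < η → Fintype.card ι * ∫ s : ℝ, 1 / ((s : ℂ) - η * Complex.I) ∂μ =
      ∑ x, m η x) {η : ℝ} (hη : 0 < η) :
    Fintype.card ι * ∫ s : ℝ, Real.log (s ^ 2 + η ^ 2) / 2 ∂μ =
      freeEnergy A J (fun _ => η * Complex.I) (m η) := by
  -- Both terms have η-derivative Im ∑ m_x, so D is constant; both are card · log η + o(1) at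
  -- infinity, so the constant is 0.
  let D : ℝ → ℝ := fun η => Fintype.card ι * ∫ s : ℝ, Real.log (s ^ 2 + η ^ 2) / 2 ∂μ -
    freeEnergy A J (fun _ => η * Complex.I) (m η)
  have hD : ∀ η ∈ Set.Ioi (0 : ℝ), HasDerivAt D 0 η := fun η hη => by
    have hη : 0 < η := hη
    have h1 := (hasDerivAt_integral_log_sq_add_sq h2 hη).const_mul (Fintype.card ι : ℝ)
    have hp' : HasDerivAt (fun (η : ℝ) (_ : ι) => (η : ℂ) * Complex.I) (fun _ => Complex.I) η := by
      rw [hasDerivAt_pi]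
      intro _
      simpa using (Complex.ofRealCLM.hasDerivAt (x := η)).mul_const Complex.I
    have h3 := hasDerivAt_freeEnergy hA hJ (half_pos hη) hp'
      (by
        filter_upwards [Ioi_mem_nhds (half_lt_self hη)] with t ht x
        simpa using (Set.mem_Ioi.mp ht).le)
      (m := m) (by
        filter_upwards [Ioi_mem_nhds hη] with t ht using hm t ht)
    have h4 := h1.sub h3
    convert! h4 using 1
    have h5 := congrArg Complex.im (hμ η hη)
    rw [← Complex.ofReal_natCast, Complex.im_ofReal_mul] at h5
    rw [h5, ← Finset.sum_mul]
    simp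
  have hconst : ∀ ξ ∈ Set.Ioi (0 : ℝ), D ξ = D η := fun ξ hξ =>
    isOpen_Ioi.is_const_of_deriv_eq_zero isPreconnected_Ioi
      (fun t ht => (hD t ht).differentiableAt.differentiableWithinAt)
      (fun t ht => (hD t ht).deriv) hξ hη
  have hlim : Tendsto D atTop (𝓝 0) := by
    have h1 := ((tendsto_integral_log_sq_add_sq_sub h2).const_mul (Fintype.card ι : ℝ)).sub
      (tendsto_freeEnergy_sub_log hA hm)
    simp only [mul_zero, sub_zero] at h1
    refine h1.congr fun ξ => ?_
    simp only [D]
    ring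
  have hlim2 : Tendsto D atTop (𝓝 (D η)) :=
    tendsto_const_nhds.congr' (by
      filter_upwards [eventually_gt_atTop 0] with ξ hξ using (hconst ξ hξ).symm)
  exact sub_eq_zero.mp (tendsto_nhds_unique hlim2 hlim)

/-- The free energy minus the quadratic confinement is concave in the potential. -/
theorem concaveOn_freeEnergy (hA : A.IsSymm) (hJ : 0 < J) {η : ℝ} (hη : 0 < η)
    {m : EuclideanSpace ℝ ι → ι → ℂ}
    (hm : ∀ u : EuclideanSpace ℝ ι, IsDysonSolution A J (fun x => η * Complex.I - u x) (m u)) :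
    ConcaveOn ℝ Set.univ fun u : EuclideanSpace ℝ ι =>
      freeEnergy A J (fun x => η * Complex.I - u x) (m u) - ‖u‖ ^ 2 / (2 * J ^ 2) := by
  refine ⟨convex_univ, fun u _ w _ a b ha hb hab => ?_⟩
  set v := w - u with hv
  let c : ℝ → EuclideanSpace ℝ ι := fun t => u + t • v
  let g : ℝ → ℝ := fun t => freeEnergy A J (fun x => η * Complex.I - c t x) (m (c t)) -
    ‖c t‖ ^ 2 / (2 * J ^ 2)
  have hpη : ∀ t : ℝ, ∀ x, η ≤ (η * Complex.I - (c t x : ℂ)).im := fun t x => by simp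
  have hg : ∀ t, HasDerivAt g ((∑ x, v x * (m (c t) x).re) - (∑ x, v x * c t x) / J ^ 2) t :=
    fun t => by
    have hc : ∀ x, HasDerivAt (fun t => c t x) (v x) t := fun x => by
      simpa [c] using ((hasDerivAt_id t).mul_const (v x)).const_add (u x)
    have hp' : HasDerivAt (fun (t : ℝ) (x : ι) => (η : ℂ) * Complex.I - (c t x : ℂ))
        (fun x => -(v x : ℂ)) t := by
      rw [hasDerivAt_pi]
      exact fun x => (hc x).ofReal_comp.const_sub _
    have h1 := hasDerivAt_freeEnergy hA hJ hη hp' (Eventually.of_forall hpη)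
      (m := fun t => m (c t)) (Eventually.of_forall fun t => hm (c t))
    have h2 : HasDerivAt (fun t => ‖c t‖ ^ 2 / (2 * J ^ 2)) ((∑ x, v x * c t x) / J ^ 2) t := by
      simp only [EuclideanSpace.real_norm_sq_eq]
      have h3 : HasDerivAt (fun t => ∑ x, c t x ^ 2) (∑ x, 2 * c t x * v x) t :=
        HasDerivAt.fun_sum fun x _ => by simpa using (hc x).fun_pow 2
      convert! h3.div_const (2 * J ^ 2) using 1
      have : ∑ x, 2 * c t x * v x = 2 * ∑ x, v x * c t x := by
        rw [Finset.mul_sum]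
        exact Finset.sum_congr rfl fun x _ => by ring
      rw [this]
      field_simp
    convert! h1.sub h2 using 1
    congr 1
    rw [Complex.re_sum, ← Finset.sum_neg_distrib]
    refine Finset.sum_congr rfl fun x _ => ?_
    simp [mul_comm]
  -- The derivative is J⁻² ∑ v_x Re ω_x, while p moves by -v per unit time, so monotonicity of Re ω
  -- in p makes it decrease.
  have hanti : Antitone (deriv g) := by
    have hd : deriv g = fun t => (∑ x, v x * (m (c t) x).re) - (∑ x, v x * c t x) / J ^ 2 :=
      funext fun t => (hg t).deriv
    rw [hd]
    intro t s hts
    rcases hts.eq_or_lt with rfl | hlt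
    · exact le_rfl
    have h1 := IsDysonSolution.sum_re_sub_mul_nonneg hJ hη hA (hpη t) (hpη s) (hm (c t)) (hm (c s))
      (fun x => by simp)
    have hterm : ∀ x, ((η * Complex.I - (c t x : ℂ)) - (η * Complex.I - (c s x : ℂ))).re *
        ((η * Complex.I - (c t x : ℂ) + (J : ℂ) ^ 2 * m (c t) x) -
          (η * Complex.I - (c s x : ℂ) + (J : ℂ) ^ 2 * m (c s) x)).re =
        (s - t) * (J ^ 2 * ((v x * (m (c t) x).re - v x * c t x / J ^ 2) -
          (v x * (m (c s) x).re - v x * c s x / J ^ 2))) := fun x => by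
      have hcs : c s x = c t x + (s - t) * v x := by
        simp only [c, PiLp.add_apply, PiLp.smul_apply, smul_eq_mul]
        ring
      rw [← Complex.ofReal_pow]
      simp only [Complex.sub_re, Complex.add_re, Complex.re_ofReal_mul, Complex.ofReal_re, hcs]
      field_simp
      ring
    simp only [hterm, ← Finset.mul_sum] at h1
    have h2 := nonneg_of_mul_nonneg_right h1 (sub_pos.mpr hlt)
    have h3 := nonneg_of_mul_nonneg_right h2 (by positivity)
    simp only [Finset.sum_sub_distrib, ← Finset.sum_div] at h3
    linarith
  have hconc := hanti.concaveOn_univ_of_deriv (fun t => (hg t).differentiableAt)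
  have h1 := hconc.2 (Set.mem_univ 0) (Set.mem_univ 1) ha hb hab
  have hc0 : c 0 = u := by simp [c]
  have hc1 : c 1 = w := by simp [c, hv]
  have hcb : c (a • 0 + b • 1) = a • u + b • w := by
    obtain rfl : a = 1 - b := by linarith
    ext x
    simp only [c, hv, smul_eq_mul, PiLp.add_apply, PiLp.smul_apply, PiLp.sub_apply]
    ring
  simp only [g, hcb, hc0, hc1] at h1
  exact h1

end FreeEnergy

/-! ### Application to the periodic lattice. -/

section Lattice

open Filter Topology

variable {L d : ℕ}

theorem laplacian_isSymm (L d : ℕ) : (laplacian L d).IsSymm := by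
  ext x y
  simp only [laplacian, Matrix.transpose_apply, Matrix.of_apply]
  congr 1
  · refine Finset.sum_congr rfl fun i _ => ?_
    rw [add_comm]
    congr 1
    · simp only [eq_sub_iff_add_eq, eq_comm]
    · simp only [eq_sub_iff_add_eq, eq_comm]
  · simp only [eq_comm]

theorem aMatrix_isSymm (μ₀ t₀ : ℝ) (u : EuclideanSpace ℝ (Site L d)) :
    (aMatrix L d μ₀ t₀ u).IsSymm :=
  (((laplacian_isSymm L d).smul t₀).neg.add (Matrix.isSymm_diagonal _)).add
    (Matrix.isSymm_one.smul μ₀)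

/-- Absorbs the potential into the spectral parameter, so that different u are compared over one
fixed matrix. -/
theorem aMatrix_map_sub_diagonal (μ₀ t₀ : ℝ) (u : EuclideanSpace ℝ (Site L d))
    (ω : Site L d → ℂ) :
    (aMatrix L d μ₀ t₀ u).map (fun r : ℝ => (r : ℂ)) - Matrix.diagonal ω =
      (aMatrix L d μ₀ t₀ 0).map (fun r : ℝ => (r : ℂ)) -
        Matrix.diagonal fun x => ω x - u x := by
  ext x y
  by_cases h : x = y
  · subst h
    simp [aMatrix]
    ring
  · simp [aMatrix, h]

variable [NeZero L] {μ₀ t₀ J : ℝ}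

theorem isMDESolution_iff {u : EuclideanSpace ℝ (Site L d)} {z : ℂ} {m : Site L d → ℂ} :
    IsMDESolution L d μ₀ t₀ J u z m ↔
      IsDysonSolution (aMatrix L d μ₀ t₀ u) J (fun _ => z) m := by
  have h : (aMatrix L d μ₀ t₀ u).map (fun r : ℝ => (r : ℂ)) -
      ((J : ℂ) ^ 2) • Matrix.diagonal m - z • (1 : Matrix (Site L d) (Site L d) ℂ) =
      (aMatrix L d μ₀ t₀ u).map (fun r : ℝ => (r : ℂ)) -
        Matrix.diagonal fun y => z + (J : ℂ) ^ 2 * m y := by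
    ext x y
    by_cases hxy : x = y
    · subst hxy
      simp
      ring
    · simp [hxy]
  rw [IsMDESolution, IsDysonSolution, h]
  rfl

theorem isDysonSolution_shift_iff {u : EuclideanSpace ℝ (Site L d)} {z : ℂ} {m : Site L d → ℂ} :
    IsDysonSolution (aMatrix L d μ₀ t₀ u) J (fun _ => z) m ↔
      IsDysonSolution (aMatrix L d μ₀ t₀ 0) J (fun x => z - u x) m := by
  simp only [IsDysonSolution, resolvent, aMatrix_map_sub_diagonal μ₀ t₀ u, add_sub_right_comm]

theorem freeEnergy_shift (u : EuclideanSpace ℝ (Site L d)) (z : ℂ) (m : Site L d → ℂ) :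
    freeEnergy (aMatrix L d μ₀ t₀ u) J (fun _ => z) m =
      freeEnergy (aMatrix L d μ₀ t₀ 0) J (fun x => z - u x) m := by
  simp only [freeEnergy, detSub, aMatrix_map_sub_diagonal μ₀ t₀ u, add_sub_right_comm]

theorem existsUnique_isMDESolution (hJ : 0 < J) (u : EuclideanSpace ℝ (Site L d)) {z : ℂ}
    (hz : 0 < z.im) : ∃! m, IsMDESolution L d μ₀ t₀ J u z m := by
  simp only [isMDESolution_iff]
  obtain ⟨m, hm, -⟩ := exists_isDysonSolution_tendsto (p := fun _ => z) hJ hz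
    (aMatrix_isSymm μ₀ t₀ u) fun _ => le_rfl
  exact ⟨m, hm, fun m' hm' =>
    IsDysonSolution.unique hJ hz (aMatrix_isSymm μ₀ t₀ u) (fun _ => le_rfl) hm' hm⟩

theorem isDysonSolution_mInfty (hJ : 0 < J) (u : EuclideanSpace ℝ (Site L d)) {z : ℂ}
    (hz : 0 < z.im) :
    IsDysonSolution (aMatrix L d μ₀ t₀ u) J (fun _ => z) (mInfty L d μ₀ t₀ J u z) :=
  isMDESolution_iff.mp (Classical.epsilon_spec (existsUnique_isMDESolution hJ u hz).exists)

theorem card_site : Fintype.card (Site L d) = L ^ d := by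
  rw [Fintype.card_fun, ZMod.card, Fintype.card_fin]

theorem exists_isMuInfty (hJ : 0 < J) (u : EuclideanSpace ℝ (Site L d)) :
    ∃ μ, IsMuInfty L d μ₀ t₀ J u μ ∧ Integrable (fun s : ℝ => s ^ 2) μ := by
  choose ν hν1 hν2 hν3 using fun x =>
    exists_measure_stieltjes_isDysonSolution (aMatrix_isSymm (L := L) (d := d) μ₀ t₀ u) hJ x
  have hn : (Fintype.card (Site L d) : ENNReal) ≠ 0 := by
    exact_mod_cast Fintype.card_ne_zero
  have hinv : (Fintype.card (Site L d) : ENNReal)⁻¹ ≠ ⊤ := ENNReal.inv_ne_top.mpr hn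
  refine ⟨(Fintype.card (Site L d) : ENNReal)⁻¹ • ∑ x, ν x, ⟨⟨?_⟩, fun z hz => ?_⟩, ?_⟩
  · simp only [Measure.smul_apply, Measure.coe_finsetSum, Finset.sum_apply, measure_univ,
      Finset.sum_const, Finset.card_univ, nsmul_eq_mul, mul_one, smul_eq_mul]
    exact ENNReal.inv_mul_cancel hn (ENNReal.natCast_ne_top _)
  · rw [integral_smul_measure, integral_finsetSum_measure fun x _ => integrable_one_div_sub (ν x) hz]
    simp only [fun x => hν2 x z _ hz (isDysonSolution_mInfty hJ u hz)]
    rw [ENNReal.toReal_inv, ENNReal.toReal_natCast, card_site, Complex.real_smul]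
    simp
  · exact (integrable_finsetSum_measure.mpr fun x _ => hν3 x).smul_measure hinv

theorem IsMuInfty.eq {u : EuclideanSpace ℝ (Site L d)} {μ ν : Measure ℝ}
    (hμ : IsMuInfty L d μ₀ t₀ J u μ) (hν : IsMuInfty L d μ₀ t₀ J u ν) : μ = ν := by
  have := hμ.1
  have := hν.1
  exact measure_eq_of_stieltjes_eq fun z hz => (hμ.2 z hz).trans (hν.2 z hz).symm

theorem isMuInfty_muInfty (hJ : 0 < J) (u : EuclideanSpace ℝ (Site L d)) :
    IsMuInfty L d μ₀ t₀ J u (muInfty L d μ₀ t₀ J u) :=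
  Classical.epsilon_spec ((exists_isMuInfty hJ u).imp fun _ h => h.1)

theorem integrable_sq_muInfty (hJ : 0 < J) (u : EuclideanSpace ℝ (Site L d)) :
    Integrable (fun s : ℝ => s ^ 2) (muInfty L d μ₀ t₀ J u) := by
  obtain ⟨μ, hμ, h2⟩ := exists_isMuInfty (μ₀ := μ₀) (t₀ := t₀) hJ u
  rwa [(isMuInfty_muInfty hJ u).eq hμ]

theorem card_mul_stieltjes_muInfty (hJ : 0 < J) (u : EuclideanSpace ℝ (Site L d)) {z : ℂ}
    (hz : 0 < z.im) :
    Fintype.card (Site L d) * ∫ s : ℝ, 1 / ((s : ℂ) - z) ∂(muInfty L d μ₀ t₀ J u) =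
      ∑ x, mInfty L d μ₀ t₀ J u z x := by
  rw [(isMuInfty_muInfty hJ u).2 z hz, card_site]
  have : (L : ℂ) ≠ 0 := Nat.cast_ne_zero.mpr (NeZero.ne L)
  push_cast
  field_simp

/-- The limiting measure has a density bounded by `1 / J`. -/
theorem muInfty_le (hJ : 0 < J) (u : EuclideanSpace ℝ (Site L d)) :
    muInfty L d μ₀ t₀ J u ≤ ENNReal.ofReal (1 / J) • volume := by
  have := (isMuInfty_muInfty (μ₀ := μ₀) (t₀ := t₀) hJ u).1
  refine measure_le_of_im_stieltjes_le fun z hz => ?_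
  have hn : (0 : ℝ) < Fintype.card (Site L d) := by
    exact_mod_cast Fintype.card_pos
  have h1 := congrArg Complex.im (card_mul_stieltjes_muInfty (μ₀ := μ₀) (t₀ := t₀) hJ u hz)
  rw [← Complex.ofReal_natCast, Complex.im_ofReal_mul, Complex.im_sum] at h1
  refine le_of_mul_le_mul_left (h1.le.trans ?_) hn
  rw [← nsmul_eq_mul, ← Finset.card_univ]
  refine Finset.sum_le_card_nsmul _ _ _ fun x _ => ?_
  exact (le_abs_self _).trans ((Complex.abs_im_le_norm _).trans
    ((isDysonSolution_mInfty hJ u hz).norm_le hJ (aMatrix_isSymm μ₀ t₀ u) (fun _ => hz) x))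

theorem muInfty_absolutelyContinuous (hJ : 0 < J) (u : EuclideanSpace ℝ (Site L d)) :
    muInfty L d μ₀ t₀ J u ≪ volume :=
  (Measure.absolutelyContinuous_of_le (muInfty_le hJ u)).trans Measure.smul_absolutelyContinuous

theorem integrable_log_muInfty (hJ : 0 < J) (u : EuclideanSpace ℝ (Site L d)) :
    Integrable (fun x : ℝ => Real.log |x|) (muInfty L d μ₀ t₀ J u) := by
  have := (isMuInfty_muInfty (μ₀ := μ₀) (t₀ := t₀) hJ u).1
  exact integrable_log_of_le (muInfty_le hJ u) (integrable_sq_muInfty hJ u)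

/-- The regularized functional, with `log |s|` replaced by `log |s - i η|`, is concave. -/
theorem concaveOn_regularized (hJ : 0 < J) {η : ℝ} (hη : 0 < η) :
    ConcaveOn ℝ Set.univ fun u : EuclideanSpace ℝ (Site L d) =>
      ∫ s : ℝ, Real.log (s ^ 2 + η ^ 2) / 2 ∂(muInfty L d μ₀ t₀ J u) -
        ‖u‖ ^ 2 / (2 * J ^ 2 * (L : ℝ) ^ d) := by
  have hz : ∀ ξ : ℝ, 0 < ξ → 0 < ((ξ : ℂ) * Complex.I).im := fun ξ hξ => by simpa using hξ
  have hL : (0 : ℝ) < (L : ℝ) ^ d := by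
    have : (0 : ℝ) < L := Nat.cast_pos.mpr (NeZero.pos L)
    positivity
  have h1 := (concaveOn_freeEnergy (aMatrix_isSymm (L := L) (d := d) μ₀ t₀ 0) hJ hη
    (m := fun u => mInfty L d μ₀ t₀ J u (η * Complex.I))
    fun u => isDysonSolution_shift_iff.mp (isDysonSolution_mInfty hJ u (hz η hη))).smul
    (inv_nonneg.mpr hL.le)
  convert! h1 using 2 with u
  have := (isMuInfty_muInfty (μ₀ := μ₀) (t₀ := t₀) hJ u).1
  have h2 := card_mul_integral_log_eq_freeEnergy (aMatrix_isSymm μ₀ t₀ u) hJ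
    (integrable_sq_muInfty (μ₀ := μ₀) (t₀ := t₀) hJ u)
    (m := fun ξ => mInfty L d μ₀ t₀ J u (ξ * Complex.I))
    (fun ξ hξ => isDysonSolution_mInfty hJ u (hz ξ hξ))
    (fun ξ hξ => card_mul_stieltjes_muInfty hJ u (hz ξ hξ)) hη
  rw [freeEnergy_shift, card_site, Nat.cast_pow] at h2
  rw [← h2, smul_eq_mul]
  field_simp

/-- Concavity survives the pointwise limit of the regularized functionals along η = 1/(k+1). -/
theorem concaveOn_functionalS (hJ : 0 < J) :
    ConcaveOn ℝ Set.univ (functionalS L d μ₀ t₀ J) := by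
  have hlim : ∀ u : EuclideanSpace ℝ (Site L d), Tendsto (fun k : ℕ =>
      ∫ s : ℝ, Real.log (s ^ 2 + (1 / ((k : ℝ) + 1)) ^ 2) / 2 ∂(muInfty L d μ₀ t₀ J u) -
        ‖u‖ ^ 2 / (2 * J ^ 2 * (L : ℝ) ^ d)) atTop (𝓝 (functionalS L d μ₀ t₀ J u)) := fun u =>
    (tendsto_integral_log_sq_add_sq_zero (integrable_sq_muInfty hJ u)
      (muInfty_absolutelyContinuous hJ u) (integrable_log_muInfty hJ u)).sub_const _
  refine ⟨convex_univ, fun u _ w _ a b ha hb hab => ?_⟩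
  refine le_of_tendsto_of_tendsto' (((hlim u).const_smul a).add ((hlim w).const_smul b))
    (hlim (a • u + b • w)) fun k => ?_
  exact (concaveOn_regularized hJ (by positivity : 0 < 1 / ((k : ℝ) + 1))).2
    (Set.mem_univ u) (Set.mem_univ w) ha hb hab

end Lattice

end ElasticManifold

theorem proposition4p8 (L d : ℕ) [NeZero L] (hd : 0 < d) (μ₀ t₀ J : ℝ)
    (hμ₀ : 0 < μ₀) (ht₀ : 0 < t₀) (hJ : 0 < J) :
    (∀ (u : EuclideanSpace ℝ (ElasticManifold.Site L d)) (z : ℂ), 0 < z.im →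
      ∃! m : ElasticManifold.Site L d → ℂ, ElasticManifold.IsMDESolution L d μ₀ t₀ J u z m) ∧
    (∀ u : EuclideanSpace ℝ (ElasticManifold.Site L d),
      ∃! μ : Measure ℝ, ElasticManifold.IsMuInfty L d μ₀ t₀ J u μ) ∧
    (∀ u : EuclideanSpace ℝ (ElasticManifold.Site L d),
      ElasticManifold.muInfty L d μ₀ t₀ J u ≪ volume ∧
      Integrable (fun x : ℝ => Real.log |x|) (ElasticManifold.muInfty L d μ₀ t₀ J u)) ∧
    ConcaveOn ℝ Set.univ (ElasticManifold.functionalS L d μ₀ t₀ J) :=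
  ⟨fun u _ hz => ElasticManifold.existsUnique_isMDESolution hJ u hz,
    fun u => ⟨_, ElasticManifold.isMuInfty_muInfty hJ u,
      fun _ hμ => hμ.eq (ElasticManifold.isMuInfty_muInfty hJ u)⟩,
    fun u => ⟨ElasticManifold.muInfty_absolutelyContinuous hJ u,
      ElasticManifold.integrable_log_muInfty hJ u⟩,
    ElasticManifold.concaveOn_functionalS hJ⟩
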